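/- **Setting.** Let $\mathbb k$ be a commutative ring with unit. A topological groupoid $\mathcal G$ has a space of units $\mathcal G^{(0)}$, a space of arrows $\mathcal G^{(1)}$, and continuous domain, range, multiplication, inversion and unit maps ($d$, $r$, $(g,h)\mapsto gh$ defined when $d(g)=r(h)$, $g\mapsto g^{-1}$, $u$). It is étale if $d$ is a local homeomorphism, and ample if moreover $\mathcal G^{(0)}$ is Hausdorff with a basis of compact open sets ($\mathcal G^{(1)}$ need not be Hausdorff). Let $\mathrm{Bis}_c(\mathcal G)$ be the set of compact open $U\subseteq\mathcal G^{(1)}$ on which $d$ and $r$ are homeomorphisms onto their images. For $\mathcal G$ ample, $\mathbb k\mathcal G$ is the $\mathbb k$-submodule of $\mathbb k^{\mathcal G^{(1)}}$ spanned by the characteristic functions $\chi_U$, $U\in \mathrm{Bis}_c(\mathcal G)$, with the convolution product $(f_1f_2)(g)=\sum_{d(h)=d(g)}f_1(gh^{-1})f_2(h)$. Compact open subsets of $\mathcal G^{(0)}$ are regarded as elements of $\mathrm{Bis}_c(\mathcal G)$ via $u$. A right $\mathbb k\mathcal G$-module $M$ is unitary if $M\cdot\mathbb k\mathcal G=M$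 (the left side being the additive subgroup generated by the products). It is then a $\mathbb k$-module by $cm=m(ce)$ for any idempotent $e\in\mathbb k\mathcal G$ with $me=m$. Let $\mathrm{mod}\text{-}\mathbb k\mathcal G$ be the category of unitary right $\mathbb k\mathcal G$-modules and module homomorphisms. A $\mathcal G$-sheaf of $\mathbb k$-modules is a space $E$ with a local homeomorphism $p\colon E\to\mathcal G^{(0)}$, a continuous right action $(e,g)\mapsto eg$ defined when $p(e)=r(g)$, with $p(eg)=d(g)$, $e\,u(p(e))=e$ and $(eg)h=e(gh)$, and a $\mathbb k$-module structure on each stalk $E_x=p^{-1}(x)$, such that the zero section, the addition $E\times_{\mathcal G^{(0)}}E\to E$ and the scalar multiplication $\mathbb k\times E\to E$ ($\mathbb k$ discrete) are continuous and each map $E_{r(g)}\to E_{d(g)}$, $e\mapsto eg$, is $\mathbb k$-linear. Morphisms are the continuous equivariant maps over $\mathcal G^{(0)}$ that are $\mathbb k$-linear on stalks. Denote this category by $\mathcal B_{\mathbb k}\mathcal G$. **Functors.** For $\mathcal G$ ample, the functor $\Gamma_c\colon\mathcal B_{\mathbb k}\mathcal G\to\mathrm{mod}\text{-}\mathbb k\mathcal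 G$ sends $(E,p)$ to the group of continuous sections $s\colon\mathcal G^{(0)}\to E$ of $p$ with compact support $\{x\mid s(x)\neq 0\}$, with pointwise addition and the action $(sf)(x)=\sum_{d(g)=x}f(g)\,s(r(g))g$, and sends a morphism $\varphi$ to $s\mapsto\varphi\circ s$. The functor $\mathrm{Sh}\colon\mathrm{mod}\text{-}\mathbb k\mathcal G\to\mathcal B_{\mathbb k}\mathcal G$ sends $M$ to $\coprod_{x\in\mathcal G^{(0)}}M_x$ with the obvious projection, where $M_x=\varinjlim_{x\in U}M\chi_U$ over the compact open neighbourhoods $U$ of $x$, with transition maps $m\mapsto m\chi_V$ for $V\subseteq U$. Writing $[m]_x$ for the class of $m\in M$ in $M_x$, the topology is generated by the sets $(U,m)=\{[m]_x\mid x\in U\}$ with $U\subseteq \mathcal G^{(0)}$ compact open and $m\in M$, and the action is $[m]_{r(g)}g=[m\chi_U]_{d(g)}$ for any $U\in\mathrm{Bis}_c(\mathcal G)$ containing $g$. On homomorphisms, $\mathrm{Sh}(f)([m]_x)=[f(m)]_x$. **Theorem.** Let $\mathcal G$ be an ample groupoid and $\mathbb k$ a commutative ring with unit. There are natural isomorphisms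 $\Gamma_c\circ\mathrm{Sh}\cong 1_{\mathrm{mod}\text{-}\mathbb k\mathcal G}$ and $\mathrm{Sh}\circ\Gamma_c\cong 1_{\mathcal B_{\mathbb k}\mathcal G}$. Hence the categories $\mathrm{mod}\text{-}\mathbb k\mathcal G$ and $\mathcal B_{\mathbb k}\mathcal G$ are equivalent. -/

import Mathlib

open CategoryTheory Topology

universe u v w e m t

/-- A topological groupoid with unit space `X` and arrow space `G`: `d` is the domain map, `r` the
range map, and `mul g h _` is the product `gh`, defined when `d g = r h`. -/
structure TopologicalGroupoid (X : Type u) (G : Type v) [TopologicalSpace X]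
    [TopologicalSpace G] where
  d : G → X
  r : G → X
  unit : X → G
  inv : G → G
  mul : (g h : G) → d g = r h → G
  d_unit : ∀ x, d (unit x) = x
  r_unit : ∀ x, r (unit x) = x
  d_inv : ∀ g, d (inv g) = r g
  r_inv : ∀ g, r (inv g) = d g
  d_mul : ∀ g h (p : d g = r h), d (mul g h p) = d h
  r_mul : ∀ g h (p : d g = r h), r (mul g h p) = r g
  mul_assoc : ∀ g h k (p : d g = r h) (q : d h = r k),
    mul (mul g h p) k ((d_mul g h p).trans q) = mul g (mul h k q) (p.trans (r_mul h k q).symm)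
  unit_mul : ∀ g, mul (unit (r g)) g (d_unit (r g)) = g
  mul_unit : ∀ g, mul g (unit (d g)) (r_unit (d g)).symm = g
  mul_inv : ∀ g, mul g (inv g) (r_inv g).symm = unit (r g)
  inv_mul : ∀ g, mul (inv g) g (d_inv g) = unit (d g)
  continuous_d : Continuous d
  continuous_r : Continuous r
  continuous_unit : Continuous unit
  continuous_inv : Continuous inv
  continuous_mul : Continuous fun q : {q : G × G // d q.1 = r q.2} => mul q.1.1 q.1.2 q.2

namespace TopologicalGroupoid

variable {X : Type u} {G : Type v} [TopologicalSpace X] [TopologicalSpace G]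

/-- A topological groupoid is étale if its domain map is a local homeomorphism. -/
class IsEtale (𝒢 : TopologicalGroupoid X G) : Prop where
  isLocalHomeomorph_d : IsLocalHomeomorph 𝒢.d

/-- An étale groupoid is ample if its unit space is Hausdorff and has a basis of compact open
sets. The arrow space need not be Hausdorff. -/
class IsAmple (𝒢 : TopologicalGroupoid X G) : Prop extends IsEtale 𝒢 where
  t2Space : T2Space X
  isTopologicalBasis : TopologicalSpace.IsTopologicalBasis {U : Set X | IsCompact U ∧ IsOpen U}

/-- A local bisection: an open set of arrows on which `d` and `r` are homeomorphisms onto their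
images. -/
structure IsLocalBisection (𝒢 : TopologicalGroupoid X G) (U : Set G) : Prop where
  isOpen : IsOpen U
  isEmbedding_d : IsEmbedding (U.domRestrict 𝒢.d)
  isEmbedding_r : IsEmbedding (U.domRestrict 𝒢.r)

/-- The set `Bis_c(𝒢)` of compact open local bisections. -/
structure CompactBisection (𝒢 : TopologicalGroupoid X G) where
  carrier : Set G
  isLocalBisection : 𝒢.IsLocalBisection carrier
  isCompact : IsCompact carrier

section Lemmas

variable (𝒢 : TopologicalGroupoid X G)

theorem mul_congr {g g' h h' : G} (p : 𝒢.d g = 𝒢.r h) (p' : 𝒢.d g' = 𝒢.r h')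
    (hg : g = g') (hh : h = h') : 𝒢.mul g h p = 𝒢.mul g' h' p' := by
  subst hg; subst hh; rfl

theorem mul_mul_inv (g h : G) (p : 𝒢.d g = 𝒢.r h)
    (q : 𝒢.d (𝒢.mul g h p) = 𝒢.r (𝒢.inv h)) :
    𝒢.mul (𝒢.mul g h p) (𝒢.inv h) q = g := by
  rw [𝒢.mul_assoc g h (𝒢.inv h) p (𝒢.r_inv h).symm]
  rw [𝒢.mul_congr _ (𝒢.r_unit (𝒢.d g)).symm rfl ((𝒢.mul_inv h).trans (by rw [p]))]
  exact 𝒢.mul_unit g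

theorem mul_inv_mul (g h : G) (p : 𝒢.d g = 𝒢.r (𝒢.inv h))
    (q : 𝒢.d (𝒢.mul g (𝒢.inv h) p) = 𝒢.r h) :
    𝒢.mul (𝒢.mul g (𝒢.inv h) p) h q = g := by
  have p' : 𝒢.d g = 𝒢.d h := p.trans (𝒢.r_inv h)
  rw [𝒢.mul_assoc g (𝒢.inv h) h p (𝒢.d_inv h)]
  rw [𝒢.mul_congr _ (𝒢.r_unit (𝒢.d g)).symm rfl ((𝒢.inv_mul h).trans (by rw [p']))]
  exact 𝒢.mul_unit g

theorem inv_mul_mul (g h : G) (p : 𝒢.d g = 𝒢.r h)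
    (q : 𝒢.d (𝒢.inv g) = 𝒢.r (𝒢.mul g h p)) :
    𝒢.mul (𝒢.inv g) (𝒢.mul g h p) q = h := by
  rw [← 𝒢.mul_assoc (𝒢.inv g) g h (𝒢.d_inv g) p]
  rw [𝒢.mul_congr _ (𝒢.d_unit (𝒢.r h)) ((𝒢.inv_mul g).trans (by rw [p])) rfl]
  exact 𝒢.unit_mul h

theorem inv_inv (g : G) : 𝒢.inv (𝒢.inv g) = g := by
  have e : 𝒢.d (𝒢.inv (𝒢.inv g)) = 𝒢.d g := by rw [𝒢.d_inv, 𝒢.r_inv]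
  have h1 := 𝒢.inv_mul_mul (𝒢.inv g) g (𝒢.d_inv g) (by rw [𝒢.d_inv, 𝒢.r_mul])
  have h2 := 𝒢.mul_unit (𝒢.inv (𝒢.inv g))
  rw [← h2]
  refine Eq.trans ?_ h1
  exact 𝒢.mul_congr _ _ rfl ((congrArg 𝒢.unit e).trans (𝒢.inv_mul g).symm)

variable [𝒢.IsAmple]

theorem isLocalHomeomorph_d : IsLocalHomeomorph 𝒢.d := IsEtale.isLocalHomeomorph_d

theorem isLocalHomeomorph_r : IsLocalHomeomorph 𝒢.r := by
  have h : 𝒢.r = 𝒢.d ∘ (⟨⟨𝒢.inv, 𝒢.inv, 𝒢.inv_inv, 𝒢.inv_inv⟩, 𝒢.continuous_inv,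
      𝒢.continuous_inv⟩ : G ≃ₜ G) := by
    ext g; exact (𝒢.d_inv g).symm
  rw [h]
  exact 𝒢.isLocalHomeomorph_d.comp (Homeomorph.isLocalHomeomorph _)

theorem isLocalHomeomorph_unit : IsLocalHomeomorph 𝒢.unit := by
  refine IsLocalHomeomorph.of_comp (g := 𝒢.d) ?_ 𝒢.isLocalHomeomorph_d 𝒢.continuous_unit
  have : 𝒢.d ∘ 𝒢.unit = id := funext 𝒢.d_unit
  rw [this]
  exact (Homeomorph.refl X).isLocalHomeomorph

variable {𝒢} in
theorem isOpenEmbedding_restrict {Y : Type*} [TopologicalSpace Y] {f : G → Y}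
    (hf : IsLocalHomeomorph f) {U : Set G} (hU : IsOpen U) (h : Set.InjOn f U) :
    IsOpenEmbedding (U.domRestrict f) :=
  .of_continuous_injective_isOpenMap (hf.continuous.comp continuous_subtype_val)
    (Set.injOn_iff_injective.1 h) (hf.isOpenMap.domRestrict hU)

theorem isLocalBisection_of_injOn {U : Set G} (hU : IsOpen U) (hd : Set.InjOn 𝒢.d U)
    (hr : Set.InjOn 𝒢.r U) : 𝒢.IsLocalBisection U :=
  ⟨hU, (isOpenEmbedding_restrict 𝒢.isLocalHomeomorph_d hU hd).isEmbedding,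
    (isOpenEmbedding_restrict 𝒢.isLocalHomeomorph_r hU hr).isEmbedding⟩

end Lemmas

namespace CompactBisection

variable {𝒢 : TopologicalGroupoid X G}

theorem ext {U V : 𝒢.CompactBisection} (h : U.carrier = V.carrier) : U = V := by
  cases U; cases V; cases h; rfl

theorem isOpen (U : 𝒢.CompactBisection) : IsOpen U.carrier := U.isLocalBisection.isOpen

theorem injOn_d (U : 𝒢.CompactBisection) : Set.InjOn 𝒢.d U.carrier :=
  Set.injOn_iff_injective.2 U.isLocalBisection.isEmbedding_d.injective

theorem injOn_r (U : 𝒢.CompactBisection) : Set.InjOn 𝒢.r U.carrier :=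
  Set.injOn_iff_injective.2 U.isLocalBisection.isEmbedding_r.injective

/-- On the open set `d(U)`, the inverse of `d|_U` is continuous. -/
theorem exists_section (U : 𝒢.CompactBisection) :
    ∃ σ : 𝒢.d '' U.carrier → G, Continuous σ ∧ ∀ x, σ x ∈ U.carrier ∧ 𝒢.d (σ x) = x := by
  choose σ h1 h2 using fun x : 𝒢.d '' U.carrier => x.2
  refine ⟨σ, ?_, fun x => ⟨h1 x, h2 x⟩⟩
  have : Continuous fun x : 𝒢.d '' U.carrier => (⟨σ x, h1 x⟩ : U.carrier) := by
    rw [U.isLocalBisection.isEmbedding_d.continuous_iff]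
    convert continuous_subtype_val using 1
    exact funext h2
  exact continuous_subtype_val.comp this

variable [𝒢.IsAmple]

theorem isOpen_image_d (U : 𝒢.CompactBisection) : IsOpen (𝒢.d '' U.carrier) :=
  𝒢.isLocalHomeomorph_d.isOpenMap _ U.isOpen

theorem isOpen_image_r (U : 𝒢.CompactBisection) : IsOpen (𝒢.r '' U.carrier) :=
  𝒢.isLocalHomeomorph_r.isOpenMap _ U.isOpen

/-- The compact open set `d(U) = U⁻¹U` of units. -/
def dom (U : 𝒢.CompactBisection) : TopologicalSpace.CompactOpens X :=
  ⟨⟨𝒢.d '' U.carrier, U.isCompact.image 𝒢.continuous_d⟩, U.isOpen_image_d⟩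

/-- The compact open set `r(U) = UU⁻¹` of units. -/
def ran (U : 𝒢.CompactBisection) : TopologicalSpace.CompactOpens X :=
  ⟨⟨𝒢.r '' U.carrier, U.isCompact.image 𝒢.continuous_r⟩, U.isOpen_image_r⟩

/-- The product `UV = {uv | u ∈ U, v ∈ V, d(u) = r(v)}`. -/
def mulSet (U V : 𝒢.CompactBisection) : Set G :=
  {k | ∃ g ∈ U.carrier, ∃ h ∈ V.carrier, ∃ p : 𝒢.d g = 𝒢.r h, 𝒢.mul g h p = k}

theorem isOpen_mulSet (U V : 𝒢.CompactBisection) : IsOpen (mulSet U V) := by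
  obtain ⟨σ, hσ, hσV⟩ := V.exists_section
  let D : Set G := 𝒢.d ⁻¹' (𝒢.d '' V.carrier)
  have hD : IsOpen D := V.isOpen_image_d.preimage 𝒢.continuous_d
  have key : ∀ k : D, 𝒢.d k.1 = 𝒢.r (𝒢.inv (σ ⟨𝒢.d k.1, k.2⟩)) := fun k => by
    rw [𝒢.r_inv, (hσV _).2]
  let τ : D → G := fun k => 𝒢.mul k.1 (𝒢.inv (σ ⟨𝒢.d k.1, k.2⟩)) (key k)
  have hτ : Continuous τ := by
    refine 𝒢.continuous_mul.comp
      (f := fun k : D => (⟨(k.1, 𝒢.inv (σ ⟨𝒢.d k.1, k.2⟩)), key k⟩ :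
        {q : G × G // 𝒢.d q.1 = 𝒢.r q.2})) ?_
    refine Continuous.subtype_mk (continuous_subtype_val.prodMk ?_) _
    exact 𝒢.continuous_inv.comp (hσ.comp
      ((𝒢.continuous_d.comp continuous_subtype_val).subtype_mk _))
  have : mulSet U V = Subtype.val '' (τ ⁻¹' U.carrier) := by
    ext k
    constructor
    · rintro ⟨g, hg, h, hh, p, rfl⟩
      have hk : 𝒢.mul g h p ∈ D := ⟨h, hh, (𝒢.d_mul g h p).symm⟩
      refine ⟨⟨_, hk⟩, ?_, rfl⟩
      have hs : σ ⟨𝒢.d (𝒢.mul g h p), hk⟩ = h :=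
        V.injOn_d (hσV _).1 hh ((hσV _).2.trans (𝒢.d_mul g h p))
      have : τ ⟨_, hk⟩ = g := by
        refine (𝒢.mul_congr _ ?_ rfl (by rw [hs])).trans (𝒢.mul_mul_inv g h p ?_) <;>
          rw [𝒢.d_mul, 𝒢.r_inv]
      show τ ⟨_, hk⟩ ∈ U.carrier
      rwa [this]
    · rintro ⟨k, hk, rfl⟩
      refine ⟨τ k, hk, σ ⟨𝒢.d k.1, k.2⟩, (hσV _).1, ?_, 𝒢.mul_inv_mul _ _ _ _⟩
      rw [𝒢.d_mul, 𝒢.d_inv]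
  rw [this]
  exact hD.isOpenMap_subtype_val _ (U.isOpen.preimage hτ)

theorem isCompact_mulSet (U V : 𝒢.CompactBisection) : IsCompact (mulSet U V) := by
  have := IsAmple.t2Space (𝒢 := 𝒢)
  have hc : IsClosed {q : G × G | 𝒢.d q.1 = 𝒢.r q.2} :=
    isClosed_eq (𝒢.continuous_d.comp continuous_fst) (𝒢.continuous_r.comp continuous_snd)
  have := (hc.isClosedEmbedding_subtypeVal.isCompact_preimage
    (U.isCompact.prod V.isCompact)).image 𝒢.continuous_mul
  convert this using 1
  ext k
  constructor
  · rintro ⟨g, hg, h, hh, p, rfl⟩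
    exact ⟨⟨(g, h), p⟩, ⟨hg, hh⟩, rfl⟩
  · rintro ⟨⟨⟨g, h⟩, p⟩, ⟨hg, hh⟩, rfl⟩
    exact ⟨g, hg, h, hh, p, rfl⟩

/-- The product of two compact open local bisections. -/
def mul (U V : 𝒢.CompactBisection) : 𝒢.CompactBisection where
  carrier := mulSet U V
  isLocalBisection := by
    refine 𝒢.isLocalBisection_of_injOn (isOpen_mulSet U V) ?_ ?_
    · rintro _ ⟨g, hg, h, hh, p, rfl⟩ _ ⟨g', hg', h', hh', p', rfl⟩ e
      rw [𝒢.d_mul, 𝒢.d_mul] at e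
      obtain rfl := V.injOn_d hh hh' e
      obtain rfl := U.injOn_d hg hg' (p.trans p'.symm)
      rfl
    · rintro _ ⟨g, hg, h, hh, p, rfl⟩ _ ⟨g', hg', h', hh', p', rfl⟩ e
      rw [𝒢.r_mul, 𝒢.r_mul] at e
      obtain rfl := U.injOn_r hg hg' e
      obtain rfl := V.injOn_r hh hh' (p.symm.trans p')
      rfl
  isCompact := isCompact_mulSet U V

theorem mul_assoc' (U V W : 𝒢.CompactBisection) : mul (mul U V) W = mul U (mul V W) := by
  apply ext
  ext k
  constructor
  · rintro ⟨_, ⟨g, hg, h, hh, p, rfl⟩, l, hl, q, rfl⟩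
    exact ⟨g, hg, _, ⟨h, hh, l, hl, (𝒢.d_mul g h p).symm.trans q, rfl⟩, _,
      (𝒢.mul_assoc g h l p _).symm⟩
  · rintro ⟨g, hg, _, ⟨h, hh, l, hl, q, rfl⟩, p, rfl⟩
    exact ⟨_, ⟨g, hg, h, hh, p.trans (𝒢.r_mul h l q), rfl⟩, l, hl, _,
      𝒢.mul_assoc g h l _ q⟩

/-- A compact open set of units, viewed as a compact open local bisection. -/
def ofUnits (W : TopologicalSpace.CompactOpens X) : 𝒢.CompactBisection where
  carrier := 𝒢.unit '' W
  isLocalBisection := by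
    refine 𝒢.isLocalBisection_of_injOn (𝒢.isLocalHomeomorph_unit.isOpenMap _ W.isOpen) ?_ ?_
    · rintro _ ⟨x, hx, rfl⟩ _ ⟨y, hy, rfl⟩ e
      rw [𝒢.d_unit, 𝒢.d_unit] at e; rw [e]
    · rintro _ ⟨x, hx, rfl⟩ _ ⟨y, hy, rfl⟩ e
      rw [𝒢.r_unit, 𝒢.r_unit] at e; rw [e]
  isCompact := W.isCompact.image 𝒢.continuous_unit

theorem carrier_mul_ofUnits (U : 𝒢.CompactBisection) (W : TopologicalSpace.CompactOpens X) :
    (mul U (ofUnits W)).carrier = {g ∈ U.carrier | 𝒢.d g ∈ W} := by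
  ext k
  constructor
  · rintro ⟨g, hg, _, ⟨x, hx, rfl⟩, p, rfl⟩
    obtain rfl : 𝒢.d g = x := p.trans (𝒢.r_unit x)
    rw [𝒢.mul_unit]
    exact ⟨hg, hx⟩
  · rintro ⟨hk, hx⟩
    exact ⟨k, hk, _, ⟨_, hx, rfl⟩, _, 𝒢.mul_unit k⟩

theorem carrier_ofUnits_mul (U : 𝒢.CompactBisection) (W : TopologicalSpace.CompactOpens X) :
    (mul (ofUnits W) U).carrier = {g ∈ U.carrier | 𝒢.r g ∈ W} := by
  ext k
  constructor
  · rintro ⟨_, ⟨x, hx, rfl⟩, g, hg, p, rfl⟩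
    obtain rfl : x = 𝒢.r g := (𝒢.d_unit x).symm.trans p
    rw [𝒢.unit_mul]
    exact ⟨hg, hx⟩
  · rintro ⟨hk, hx⟩
    exact ⟨_, ⟨_, hx, rfl⟩, k, hk, _, 𝒢.unit_mul k⟩

end CompactBisection

section Basis

theorem exists_compactOpens (𝒢 : TopologicalGroupoid X G) [𝒢.IsAmple] {x : X} {O : Set X} (hO : IsOpen O) (hx : x ∈ O) :
    ∃ W : TopologicalSpace.CompactOpens X, x ∈ W ∧ (W : Set X) ⊆ O := by
  obtain ⟨W, ⟨h1, h2⟩, h3, h4⟩ :=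
    (IsAmple.isTopologicalBasis (𝒢 := 𝒢)).exists_subset_of_mem_open hx hO
  exact ⟨⟨⟨W, h1⟩, h2⟩, h3, h4⟩

theorem exists_compactOpens_inf (𝒢 : TopologicalGroupoid X G) [𝒢.IsAmple]
    (V W : TopologicalSpace.CompactOpens X) :
    ∃ Z : TopologicalSpace.CompactOpens X, (Z : Set X) = (V : Set X) ∩ W := by
  have := IsAmple.t2Space (𝒢 := 𝒢)
  exact ⟨⟨⟨V ∩ W, V.isCompact.inter W.isCompact⟩, V.isOpen.inter W.isOpen⟩, rfl⟩

/-- The compact open local bisections form a basis of the arrow space. -/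
theorem exists_compactBisection (𝒢 : TopologicalGroupoid X G) [𝒢.IsAmple]
    {g : G} {O : Set G} (hO : IsOpen O) (hg : g ∈ O) :
    ∃ Z : 𝒢.CompactBisection, g ∈ Z.carrier ∧ Z.carrier ⊆ O := by
  obtain ⟨A, hA, hgA, hdA⟩ := 𝒢.isLocalHomeomorph_d.isLocallyInjective g
  obtain ⟨B, hB, hgB, hrB⟩ := 𝒢.isLocalHomeomorph_r.isLocallyInjective g
  let P : Set G := A ∩ B ∩ O
  have hP : IsOpen P := (hA.inter hB).inter hO
  have hgP : g ∈ P := ⟨⟨hgA, hgB⟩, hg⟩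
  have hdP : Set.InjOn 𝒢.d P := hdA.mono fun _ h => h.1.1
  have hrP : Set.InjOn 𝒢.r P := hrB.mono fun _ h => h.1.2
  obtain ⟨W, hxW, hW⟩ := 𝒢.exists_compactOpens (𝒢.isLocalHomeomorph_d.isOpenMap _ hP)
    (Set.mem_image_of_mem 𝒢.d hgP)
  have hsub : P ∩ 𝒢.d ⁻¹' W ⊆ P := Set.inter_subset_left
  refine ⟨⟨P ∩ 𝒢.d ⁻¹' W, 𝒢.isLocalBisection_of_injOn
    (hP.inter (W.isOpen.preimage 𝒢.continuous_d)) (hdP.mono hsub) (hrP.mono hsub), ?_⟩,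
    ⟨hgP, hxW⟩, fun _ h => h.1.2⟩
  have hemb := isOpenEmbedding_restrict 𝒢.isLocalHomeomorph_d hP hdP
  have h1 := (hemb.isInducing.isCompact_preimage_iff (K := (W : Set X))
    (by rwa [Set.range_domRestrict])).2 W.isCompact
  have h2 := h1.image continuous_subtype_val
  convert h2 using 1
  ext k
  constructor
  · rintro ⟨hk, hk'⟩
    exact ⟨⟨k, hk⟩, hk', rfl⟩
  · rintro ⟨k, hk, rfl⟩
    exact ⟨k.2, hk⟩

end Basis

noncomputable section

/-- The convolution product `(f₁ * f₂)(g) = ∑_{d(h) = d(g)} f₁(gh⁻¹) f₂(h)`. The sum is finite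
whenever `f₂` has finite support on each fibre of `d`. -/
def conv (𝒢 : TopologicalGroupoid X G) {𝕜 : Type w} [CommRing 𝕜] (f₁ f₂ : G → 𝕜) : G → 𝕜 :=
  fun g => ∑ᶠ h : {h : G // 𝒢.d h = 𝒢.d g},
    f₁ (𝒢.mul g (𝒢.inv h.1) (h.2.symm.trans (𝒢.r_inv h.1).symm)) * f₂ h.1

/-- The characteristic function of `U`. -/
def charFun (𝕜 : Type w) [CommRing 𝕜] (U : Set G) : G → 𝕜 := U.indicator fun _ => 1

/-- The submodule of `𝕜^G` spanned by the characteristic functions of the compact open local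
bisections. -/
def algebraSubmodule (𝒢 : TopologicalGroupoid X G) (𝕜 : Type w) [CommRing 𝕜] :
    Submodule 𝕜 (G → 𝕜) :=
  Submodule.span 𝕜 (Set.range fun U : 𝒢.CompactBisection => charFun 𝕜 U.carrier)

/-- The groupoid algebra `𝕜𝒢`. -/
def GroupoidAlgebra (𝒢 : TopologicalGroupoid X G) (𝕜 : Type w) [CommRing 𝕜] : Type (max v w) :=
  algebraSubmodule 𝒢 𝕜

section Convolution

variable (𝒢 : TopologicalGroupoid X G) {𝕜 : Type w} [CommRing 𝕜]

instance : AddCommGroup (GroupoidAlgebra 𝒢 𝕜) :=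
  inferInstanceAs (AddCommGroup (algebraSubmodule 𝒢 𝕜))

instance : Module 𝕜 (GroupoidAlgebra 𝒢 𝕜) :=
  inferInstanceAs (Module 𝕜 (algebraSubmodule 𝒢 𝕜))

theorem charFun_of_mem {U : Set G} {g : G} (h : g ∈ U) : charFun 𝕜 U g = 1 :=
  Set.indicator_of_mem h _

theorem charFun_of_notMem {U : Set G} {g : G} (h : g ∉ U) : charFun 𝕜 U g = 0 :=
  Set.indicator_of_notMem h _

theorem finite_fiber {f : G → 𝕜} (hf : f ∈ algebraSubmodule 𝒢 𝕜) (x : X) :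
    {g : {g : G // 𝒢.d g = x} | f g.1 ≠ 0}.Finite := by
  induction hf using Submodule.span_induction with
  | mem f hf =>
    obtain ⟨U, rfl⟩ := hf
    refine Set.Subsingleton.finite fun g hg h hh => Subtype.ext (U.injOn_d ?_ ?_
      (g.2.trans h.2.symm))
    · by_contra hn; exact hg (charFun_of_notMem hn)
    · by_contra hn; exact hh (charFun_of_notMem hn)
  | zero => simp
  | add f f' _ _ h h' =>
    refine (h.union h').subset fun g hg => ?_
    by_contra hn
    simp only [Set.mem_union, Set.mem_ofPred_eq, not_or, not_not] at hn
    exact hg (by simp [hn.1, hn.2])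
  | smul c f _ h =>
    refine h.subset fun g hg hn => hg ?_
    simp [hn]

theorem conv_add_left (f f' : G → 𝕜) {k : G → 𝕜} (hk : k ∈ algebraSubmodule 𝒢 𝕜) :
    conv 𝒢 (f + f') k = conv 𝒢 f k + conv 𝒢 f' k := by
  ext g
  simp only [conv, Pi.add_apply, add_mul]
  refine finsum_add_distrib ((finite_fiber 𝒢 hk (𝒢.d g)).subset fun h hh hn => hh ?_)
    ((finite_fiber 𝒢 hk (𝒢.d g)).subset fun h hh hn => hh ?_) <;> simp [hn]

theorem conv_add_right (f : G → 𝕜) {k k' : G → 𝕜} (hk : k ∈ algebraSubmodule 𝒢 𝕜)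
    (hk' : k' ∈ algebraSubmodule 𝒢 𝕜) :
    conv 𝒢 f (k + k') = conv 𝒢 f k + conv 𝒢 f k' := by
  ext g
  simp only [conv, Pi.add_apply, mul_add]
  refine finsum_add_distrib ((finite_fiber 𝒢 hk (𝒢.d g)).subset fun h hh hn => hh ?_)
    ((finite_fiber 𝒢 hk' (𝒢.d g)).subset fun h hh hn => hh ?_) <;> simp [hn]

theorem conv_smul_left (c : 𝕜) (f : G → 𝕜) {k : G → 𝕜} (hk : k ∈ algebraSubmodule 𝒢 𝕜) :
    conv 𝒢 (c • f) k = c • conv 𝒢 f k := by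
  ext g
  simp only [conv, Pi.smul_apply, smul_mul_assoc]
  refine (smul_finsum' c ((finite_fiber 𝒢 hk (𝒢.d g)).subset fun h hh hn => hh ?_)).symm
  simp [hn]

theorem conv_smul_right (c : 𝕜) (f : G → 𝕜) {k : G → 𝕜} (hk : k ∈ algebraSubmodule 𝒢 𝕜) :
    conv 𝒢 f (c • k) = c • conv 𝒢 f k := by
  ext g
  simp only [conv, Pi.smul_apply, mul_smul_comm]
  refine (smul_finsum' c ((finite_fiber 𝒢 hk (𝒢.d g)).subset fun h hh hn => hh ?_)).symm
  simp [hn]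

theorem conv_zero_left (k : G → 𝕜) : conv 𝒢 0 k = 0 := by
  ext g; simp [conv]

theorem conv_zero_right (f : G → 𝕜) : conv 𝒢 f 0 = 0 := by
  ext g; simp [conv]

theorem conv_charFun [𝒢.IsAmple] (U V : 𝒢.CompactBisection) :
    conv 𝒢 (charFun 𝕜 U.carrier) (charFun 𝕜 V.carrier) = charFun 𝕜 (U.mul V).carrier := by
  ext k
  by_cases hk : ∃ h ∈ V.carrier, 𝒢.d h = 𝒢.d k
  · obtain ⟨h, hh, e⟩ := hk
    have h1 : ∀ h' : {h' : G // 𝒢.d h' = 𝒢.d k}, h' ≠ ⟨h, e⟩ → charFun 𝕜 U.carrier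
        (𝒢.mul k (𝒢.inv h'.1) (h'.2.symm.trans (𝒢.r_inv h'.1).symm)) *
          charFun 𝕜 V.carrier h'.1 = 0 := by
      intro h' hne
      rw [charFun_of_notMem (U := V.carrier), mul_zero]
      exact fun hm => hne (Subtype.ext (V.injOn_d hm hh (h'.2.trans e.symm)))
    unfold conv
    rw [finsum_eq_single _ _ h1, charFun_of_mem hh, mul_one]
    by_cases hU : 𝒢.mul k (𝒢.inv h) (e.symm.trans (𝒢.r_inv h).symm) ∈ U.carrier
    · rw [charFun_of_mem hU, charFun_of_mem]
      exact ⟨_, hU, h, hh, by rw [𝒢.d_mul, 𝒢.d_inv], 𝒢.mul_inv_mul _ _ _ _⟩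
    · rw [charFun_of_notMem hU, charFun_of_notMem]
      rintro ⟨g, hg, h', hh', p, rfl⟩
      obtain rfl := V.injOn_d hh hh' (e.trans (𝒢.d_mul _ _ _))
      exact hU (by rwa [𝒢.mul_mul_inv])
  · rw [charFun_of_notMem (U := (U.mul V).carrier)]
    · refine finsum_eq_zero_of_forall_eq_zero fun h => ?_
      rw [charFun_of_notMem (U := V.carrier), mul_zero]
      exact fun hm => hk ⟨h.1, hm, h.2⟩
    · rintro ⟨g, hg, h, hh, p, rfl⟩
      exact hk ⟨h, hh, (𝒢.d_mul _ _ _).symm⟩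

theorem conv_mem [𝒢.IsAmple] {f k : G → 𝕜} (hf : f ∈ algebraSubmodule 𝒢 𝕜)
    (hk : k ∈ algebraSubmodule 𝒢 𝕜) : conv 𝒢 f k ∈ algebraSubmodule 𝒢 𝕜 := by
  induction hf using Submodule.span_induction with
  | mem f hf =>
    obtain ⟨U, rfl⟩ := hf
    induction hk using Submodule.span_induction with
    | mem k hk =>
      obtain ⟨V, rfl⟩ := hk
      dsimp only
      rw [conv_charFun]
      exact Submodule.subset_span ⟨_, rfl⟩
    | zero => rw [conv_zero_right]; exact zero_mem _
    | add k k' hk hk' h h' => rw [conv_add_right 𝒢 _ hk hk']; exact add_mem h h'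
    | smul c k hk h => rw [conv_smul_right 𝒢 c _ hk]; exact Submodule.smul_mem _ _ h
  | zero => rw [conv_zero_left]; exact zero_mem _
  | add f f' _ _ h h' => rw [conv_add_left 𝒢 _ _ hk]; exact add_mem h h'
  | smul c f _ h => rw [conv_smul_left 𝒢 c _ hk]; exact Submodule.smul_mem _ _ h

end Convolution

namespace GroupoidAlgebra

variable {𝒢 : TopologicalGroupoid X G} {𝕜 : Type w} [CommRing 𝕜]

/-- The characteristic function of a compact open local bisection, as an element of `𝕜𝒢`. -/
def chi (U : 𝒢.CompactBisection) : GroupoidAlgebra 𝒢 𝕜 :=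
  ⟨charFun 𝕜 U.carrier, Submodule.subset_span ⟨U, rfl⟩⟩

theorem mem (f : GroupoidAlgebra 𝒢 𝕜) : f.1 ∈ algebraSubmodule 𝒢 𝕜 := f.2

theorem induction {P : GroupoidAlgebra 𝒢 𝕜 → Prop} (f : GroupoidAlgebra 𝒢 𝕜)
    (chi : ∀ U, P (chi U)) (zero : P 0) (add : ∀ a b, P a → P b → P (a + b))
    (smul : ∀ (c : 𝕜) a, P a → P (c • a)) : P f := by
  obtain ⟨f, hf⟩ := f
  refine Submodule.span_induction (p := fun f hf => P ⟨f, hf⟩) ?_ zero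
    (fun a b ha hb => add ⟨a, ha⟩ ⟨b, hb⟩) (fun c a ha => smul c ⟨a, ha⟩) hf
  rintro _ ⟨U, rfl⟩
  exact chi U

variable [𝒢.IsAmple]

instance : Mul (GroupoidAlgebra 𝒢 𝕜) :=
  ⟨fun f k => ⟨conv 𝒢 f.1 k.1, conv_mem 𝒢 f.2 k.2⟩⟩

theorem chi_mul_chi (U V : 𝒢.CompactBisection) :
    (chi U * chi V : GroupoidAlgebra 𝒢 𝕜) = chi (U.mul V) :=
  Subtype.ext (conv_charFun 𝒢 U V)

theorem add_mul' (a b c : GroupoidAlgebra 𝒢 𝕜) : (a + b) * c = a * c + b * c :=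
  Subtype.ext (conv_add_left 𝒢 a.1 b.1 c.2)

theorem mul_add' (a b c : GroupoidAlgebra 𝒢 𝕜) : a * (b + c) = a * b + a * c :=
  Subtype.ext (conv_add_right 𝒢 a.1 b.2 c.2)

theorem zero_mul' (a : GroupoidAlgebra 𝒢 𝕜) : 0 * a = 0 := Subtype.ext (conv_zero_left 𝒢 a.1)

theorem mul_zero' (a : GroupoidAlgebra 𝒢 𝕜) : a * 0 = 0 := Subtype.ext (conv_zero_right 𝒢 a.1)

theorem smul_mul' (c : 𝕜) (a b : GroupoidAlgebra 𝒢 𝕜) : c • a * b = c • (a * b) :=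
  Subtype.ext (conv_smul_left 𝒢 c a.1 b.2)

theorem mul_smul' (c : 𝕜) (a b : GroupoidAlgebra 𝒢 𝕜) : a * c • b = c • (a * b) :=
  Subtype.ext (conv_smul_right 𝒢 c a.1 b.2)

theorem mul_assoc' (a b c : GroupoidAlgebra 𝒢 𝕜) : a * b * c = a * (b * c) := by
  induction a using induction with
  | chi U =>
    induction b using induction with
    | chi V =>
      induction c using induction with
      | chi W => rw [chi_mul_chi, chi_mul_chi, chi_mul_chi, chi_mul_chi,
          CompactBisection.mul_assoc']
      | zero => simp only [mul_zero']
      | add a b ha hb => simp only [mul_add', ha, hb]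
      | smul c a ha => simp only [mul_smul', ha]
    | zero => simp only [mul_zero', zero_mul']
    | add a b ha hb => simp only [mul_add', add_mul', ha, hb]
    | smul c a ha => simp only [mul_smul', smul_mul', ha]
  | zero => simp only [zero_mul']
  | add a b ha hb => simp only [add_mul', ha, hb]
  | smul c a ha => simp only [smul_mul', ha]

/-- `𝕜𝒢` is a (not necessarily unital) ring under convolution. -/
instance : NonUnitalRing (GroupoidAlgebra 𝒢 𝕜) where
  left_distrib := mul_add'
  right_distrib := add_mul'
  zero_mul := zero_mul'
  mul_zero := mul_zero'
  mul_assoc := mul_assoc'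

instance : IsScalarTower 𝕜 (GroupoidAlgebra 𝒢 𝕜) (GroupoidAlgebra 𝒢 𝕜) := ⟨smul_mul'⟩

instance : SMulCommClass 𝕜 (GroupoidAlgebra 𝒢 𝕜) (GroupoidAlgebra 𝒢 𝕜) :=
  ⟨fun c a b => (mul_smul' c a b).symm⟩

/-- The characteristic function `χ_W` of a compact open set of units. -/
def chiUnits (W : TopologicalSpace.CompactOpens X) : GroupoidAlgebra 𝒢 𝕜 :=
  chi (CompactBisection.ofUnits W)

theorem chi_mul_chiUnits (U Z : 𝒢.CompactBisection) (W : TopologicalSpace.CompactOpens X)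
    (h : Z.carrier = {g ∈ U.carrier | 𝒢.d g ∈ W}) :
    (chi U * chiUnits W : GroupoidAlgebra 𝒢 𝕜) = chi Z := by
  rw [chiUnits, chi_mul_chi]
  exact congrArg chi (CompactBisection.ext ((U.carrier_mul_ofUnits W).trans h.symm))

theorem chiUnits_mul_chi (U Z : 𝒢.CompactBisection) (W : TopologicalSpace.CompactOpens X)
    (h : Z.carrier = {g ∈ U.carrier | 𝒢.r g ∈ W}) :
    (chiUnits W * chi U : GroupoidAlgebra 𝒢 𝕜) = chi Z := by
  rw [chiUnits, chi_mul_chi]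
  exact congrArg chi (CompactBisection.ext ((U.carrier_ofUnits_mul W).trans h.symm))

theorem chiUnits_mul_chiUnits (V W Z : TopologicalSpace.CompactOpens X)
    (h : (Z : Set X) = (V : Set X) ∩ W) :
    (chiUnits V * chiUnits W : GroupoidAlgebra 𝒢 𝕜) = chiUnits Z := by
  refine chi_mul_chiUnits _ _ _ ?_
  ext g
  constructor
  · rintro ⟨x, hx, rfl⟩
    rw [h] at hx
    exact ⟨⟨x, hx.1, rfl⟩, by rw [𝒢.d_unit]; exact hx.2⟩
  · rintro ⟨⟨x, hx, rfl⟩, hy⟩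
    rw [𝒢.d_unit] at hy
    exact ⟨x, by rw [h]; exact ⟨hx, hy⟩, rfl⟩

theorem chiUnits_mul_of_le {V W : TopologicalSpace.CompactOpens X} (h : V ≤ W) :
    (chiUnits V * chiUnits W : GroupoidAlgebra 𝒢 𝕜) = chiUnits V :=
  chiUnits_mul_chiUnits V W V (Set.inter_eq_left.2 h).symm

theorem chiUnits_mul_of_ge {V W : TopologicalSpace.CompactOpens X} (h : V ≤ W) :
    (chiUnits W * chiUnits V : GroupoidAlgebra 𝒢 𝕜) = chiUnits V :=
  chiUnits_mul_chiUnits W V V (Set.inter_eq_right.2 h).symm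

theorem mul_chiUnits_of_le {f : GroupoidAlgebra 𝒢 𝕜} {V W : TopologicalSpace.CompactOpens X}
    (h : V ≤ W) (hf : f * chiUnits V = f) : f * chiUnits W = f := by
  rw [← hf, _root_.mul_assoc, chiUnits_mul_of_le h]

theorem exists_mul_chiUnits (f : GroupoidAlgebra 𝒢 𝕜) :
    ∃ W : TopologicalSpace.CompactOpens X, f * chiUnits W = f := by
  induction f using induction with
  | chi U => exact ⟨U.dom, chi_mul_chiUnits _ _ _ (by
      ext g; exact ⟨fun h => ⟨h, g, h, rfl⟩, fun h => h.1⟩)⟩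
  | zero => exact ⟨⊥, zero_mul _⟩
  | add a b ha hb =>
    obtain ⟨V, hV⟩ := ha
    obtain ⟨W, hW⟩ := hb
    exact ⟨V ⊔ W, by rw [add_mul, mul_chiUnits_of_le le_sup_left hV,
      mul_chiUnits_of_le le_sup_right hW]⟩
  | smul c a ha =>
    obtain ⟨V, hV⟩ := ha
    exact ⟨V, by rw [smul_mul_assoc, hV]⟩

end GroupoidAlgebra

end

end TopologicalGroupoid

/-- A unitary right module over a (not necessarily unital) ring `R`: an additive group with a
biadditive, associative right action such that `MR = M`, where `MR` is the additive subgroup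
generated by the elements `m · a`. -/
structure UnitaryRightModule.{a, b} (R : Type a) [NonUnitalRing R] where
  carrier : Type b
  [addCommGroup : AddCommGroup carrier]
  /-- `act m a` is `m · a`. -/
  act : carrier →+ R →+ carrier
  act_mul : ∀ m a b, act m (a * b) = act (act m a) b
  unitary : AddSubgroup.closure (Set.range fun q : carrier × R => act q.1 q.2) = ⊤

namespace UnitaryRightModule

universe a b

attribute [instance] addCommGroup

/-- Homomorphisms of right modules. -/
@[ext]
structure Hom {R : Type a} [NonUnitalRing R] (M N : UnitaryRightModule.{a, b} R) where
  toAddMonoidHom : M.carrier →+ N.carrier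
  map_act : ∀ m a, toAddMonoidHom (M.act m a) = N.act (toAddMonoidHom m) a

/-- The category `mod-R` of unitary right `R`-modules. -/
instance {R : Type a} [NonUnitalRing R] : Category.{b} (UnitaryRightModule.{a, b} R) where
  Hom M N := Hom M N
  id M := ⟨AddMonoidHom.id _, fun _ _ => rfl⟩
  comp f g := ⟨g.toAddMonoidHom.comp f.toAddMonoidHom, fun m a => by
    simp only [AddMonoidHom.comp_apply, f.map_act, g.map_act]⟩

end UnitaryRightModule

namespace TopologicalGroupoid

variable {X : Type u} {G : Type v} [TopologicalSpace X] [TopologicalSpace G]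

/-- A `𝒢`-sheaf: a right `𝒢`-space `(E, p)` such that `p` is a local homeomorphism. The action
`act a g _` is `ag`, defined when `p a = r g`. -/
structure GSheaf (𝒢 : TopologicalGroupoid X G) where
  E : Type e
  [topologicalSpace : TopologicalSpace E]
  p : E → X
  isLocalHomeomorph_p : IsLocalHomeomorph p
  act : (a : E) → (g : G) → p a = 𝒢.r g → E
  continuous_act : Continuous fun q : {q : E × G // p q.1 = 𝒢.r q.2} => act q.1.1 q.1.2 q.2
  act_unit : ∀ a, act a (𝒢.unit (p a)) (𝒢.r_unit (p a)).symm = a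
  p_act : ∀ a g (h : p a = 𝒢.r g), p (act a g h) = 𝒢.d g
  act_act : ∀ a g g' (h : p a = 𝒢.r g) (h' : 𝒢.d g = 𝒢.r g'),
    act (act a g h) g' ((p_act a g h).trans h') =
      act a (𝒢.mul g g' h') (h.trans (𝒢.r_mul g g' h').symm)

attribute [instance] GSheaf.topologicalSpace

/-- The stalk `E_x = p⁻¹(x)`. -/
def GSheaf.Stalk {𝒢 : TopologicalGroupoid X G} (ℰ : 𝒢.GSheaf) (x : X) : Type _ :=
  {a : ℰ.E // ℰ.p a = x}

/-- A point of the fibre over `x`, as an element of the stalk at `x`. -/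
abbrev GSheaf.toStalk {𝒢 : TopologicalGroupoid X G} (ℰ : 𝒢.GSheaf) {x : X} (a : ℰ.E)
    (h : ℰ.p a = x) : ℰ.Stalk x :=
  ⟨a, h⟩

/-- The map `R_g : E_{r(g)} → E_{d(g)}`, `a ↦ ag`. -/
def GSheaf.R {𝒢 : TopologicalGroupoid X G} (ℰ : 𝒢.GSheaf) (g : G) (a : ℰ.Stalk (𝒢.r g)) :
    ℰ.Stalk (𝒢.d g) :=
  ⟨ℰ.act a.1 g a.2, ℰ.p_act a.1 g a.2⟩

/-- A `𝒢`-sheaf of `𝕜`-modules: a `𝒢`-sheaf whose stalks are `𝕜`-modules, such that the zero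
section, the addition `E ×_X E → E` and the scalar multiplication `𝕜 × E → E` (where `𝕜` is
discrete) are continuous and each `R_g` is `𝕜`-linear. -/
structure ModuleSheaf (𝒢 : TopologicalGroupoid X G) (𝕜 : Type w) [CommRing 𝕜]
    extends GSheaf.{u, v, e} 𝒢 where
  [addCommGroup : ∀ x, AddCommGroup (toGSheaf.Stalk x)]
  [module : ∀ x, Module 𝕜 (toGSheaf.Stalk x)]
  continuous_zero : Continuous fun x => (0 : toGSheaf.Stalk x).1
  continuous_add : Continuous fun q : {q : E × E // p q.1 = p q.2} =>
    (toGSheaf.toStalk q.1.1 q.2 + toGSheaf.toStalk q.1.2 rfl).1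
  continuous_smul : ∀ c : 𝕜, Continuous fun a : E => (c • toGSheaf.toStalk a rfl).1
  R_add : ∀ g (a b : toGSheaf.Stalk (𝒢.r g)),
    toGSheaf.R g (a + b) = toGSheaf.R g a + toGSheaf.R g b
  R_smul : ∀ g (c : 𝕜) (a : toGSheaf.Stalk (𝒢.r g)), toGSheaf.R g (c • a) = c • toGSheaf.R g a

attribute [instance] ModuleSheaf.addCommGroup ModuleSheaf.module

/-- Morphisms of `𝒢`-sheaves: continuous equivariant maps over the unit space. -/
@[ext]
structure GSheaf.Hom {𝒢 : TopologicalGroupoid X G} (ℰ ℱ : GSheaf.{u, v, e} 𝒢) where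
  toFun : ℰ.E → ℱ.E
  continuous_toFun : Continuous toFun
  p_toFun : ∀ a, ℱ.p (toFun a) = ℰ.p a
  map_act : ∀ a g (h : ℰ.p a = 𝒢.r g),
    toFun (ℰ.act a g h) = ℱ.act (toFun a) g ((p_toFun a).trans h)

/-- The map on stalks induced by a morphism. -/
def GSheaf.Hom.stalkMap {𝒢 : TopologicalGroupoid X G} {ℰ ℱ : GSheaf.{u, v, e} 𝒢}
    (φ : GSheaf.Hom ℰ ℱ) (x : X) (a : ℰ.Stalk x) : ℱ.Stalk x :=
  ⟨φ.toFun a.1, (φ.p_toFun a.1).trans a.2⟩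

/-- Morphisms of `𝒢`-sheaves of `𝕜`-modules: morphisms of `𝒢`-sheaves that are `𝕜`-linear on
stalks. -/
@[ext]
structure ModuleSheaf.Hom {𝒢 : TopologicalGroupoid X G} {𝕜 : Type w} [CommRing 𝕜]
    (ℰ ℱ : ModuleSheaf.{u, v, w, e} 𝒢 𝕜) extends GSheaf.Hom ℰ.toGSheaf ℱ.toGSheaf where
  map_add : ∀ x (a b : ℰ.Stalk x),
    toHom.stalkMap x (a + b) = toHom.stalkMap x a + toHom.stalkMap x b
  map_smul : ∀ x (c : 𝕜) (a : ℰ.Stalk x), toHom.stalkMap x (c • a) = c • toHom.stalkMap x a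

/-- The category of `𝒢`-sheaves of `𝕜`-modules. -/
instance {𝒢 : TopologicalGroupoid X G} {𝕜 : Type w} [CommRing 𝕜] :
    Category.{e} (ModuleSheaf.{u, v, w, e} 𝒢 𝕜) where
  Hom ℰ ℱ := ModuleSheaf.Hom ℰ ℱ
  id ℰ := ⟨⟨id, continuous_id, fun _ => rfl, fun _ _ _ => rfl⟩, fun _ _ _ => rfl,
    fun _ _ _ => rfl⟩
  comp φ ψ := ⟨⟨ψ.toFun ∘ φ.toFun, ψ.continuous_toFun.comp φ.continuous_toFun,
    fun a => (ψ.p_toFun _).trans (φ.p_toFun a),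
    fun a g h => by simp only [Function.comp_apply, φ.map_act, ψ.map_act]⟩,
    fun x a b => (congrArg (ψ.stalkMap x) (φ.map_add x a b)).trans (ψ.map_add x _ _),
    fun x c a => (congrArg (ψ.stalkMap x) (φ.map_smul x c a)).trans (ψ.map_smul x c _)⟩

noncomputable section

namespace ModuleSheaf

variable {𝒢 : TopologicalGroupoid X G} {𝕜 : Type w} [CommRing 𝕜]
  (ℰ : ModuleSheaf.{u, v, w, e} 𝒢 𝕜)

/-- The `𝕜`-linear map `E_{r(g)} → E_x`, `a ↦ ag`, for an arrow `g` with `d(g) = x`. -/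
def move {x : X} (g : {g : G // 𝒢.d g = x}) : ℰ.Stalk (𝒢.r g.1) →ₗ[𝕜] ℰ.Stalk x where
  toFun a := ⟨ℰ.act a.1 g.1 a.2, (ℰ.p_act a.1 g.1 a.2).trans g.2⟩
  map_add' := by obtain ⟨g, rfl⟩ := g; exact ℰ.R_add g
  map_smul' := by obtain ⟨g, rfl⟩ := g; exact ℰ.R_smul g

/-- The formula `(sf)(x) = ∑_{d(g) = x} f(g) s(r(g))g`. -/
def sectionAct (s : ∀ x, ℰ.Stalk x) (f : G → 𝕜) : ∀ x, ℰ.Stalk x :=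
  fun x => ∑ᶠ g : {g : G // 𝒢.d g = x}, f g.1 • ℰ.move g (s (𝒢.r g.1))

theorem sectionAct_finite (s : ∀ x, ℰ.Stalk x) {f : G → 𝕜} (hf : f ∈ algebraSubmodule 𝒢 𝕜)
    (x : X) : (Function.support fun g : {g : G // 𝒢.d g = x} =>
      f g.1 • ℰ.move g (s (𝒢.r g.1))).Finite :=
  (finite_fiber 𝒢 hf x).subset fun g hg hn => hg (by simp [hn])

theorem sectionAct_add_left (s t : ∀ x, ℰ.Stalk x) {f : G → 𝕜}
    (hf : f ∈ algebraSubmodule 𝒢 𝕜) :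
    ℰ.sectionAct (s + t) f = ℰ.sectionAct s f + ℰ.sectionAct t f := by
  ext1 x
  simp only [sectionAct, Pi.add_apply, map_add, smul_add]
  exact finsum_add_distrib (ℰ.sectionAct_finite s hf x) (ℰ.sectionAct_finite t hf x)

theorem sectionAct_smul_left (c : 𝕜) (s : ∀ x, ℰ.Stalk x) {f : G → 𝕜}
    (hf : f ∈ algebraSubmodule 𝒢 𝕜) :
    ℰ.sectionAct (c • s) f = c • ℰ.sectionAct s f := by
  ext1 x
  simp only [sectionAct, Pi.smul_apply, map_smul, smul_comm _ c]
  exact (smul_finsum' c (ℰ.sectionAct_finite s hf x)).symm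

theorem sectionAct_add_right (s : ∀ x, ℰ.Stalk x) {f k : G → 𝕜}
    (hf : f ∈ algebraSubmodule 𝒢 𝕜) (hk : k ∈ algebraSubmodule 𝒢 𝕜) :
    ℰ.sectionAct s (f + k) = ℰ.sectionAct s f + ℰ.sectionAct s k := by
  ext1 x
  simp only [sectionAct, Pi.add_apply, add_smul]
  exact finsum_add_distrib (ℰ.sectionAct_finite s hf x) (ℰ.sectionAct_finite s hk x)

theorem sectionAct_smul_right (c : 𝕜) (s : ∀ x, ℰ.Stalk x) {f : G → 𝕜}
    (hf : f ∈ algebraSubmodule 𝒢 𝕜) :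
    ℰ.sectionAct s (c • f) = c • ℰ.sectionAct s f := by
  ext1 x
  simp only [sectionAct, Pi.smul_apply, smul_assoc]
  exact (smul_finsum' c (ℰ.sectionAct_finite s hf x)).symm

theorem sectionAct_zero_left (f : G → 𝕜) : ℰ.sectionAct 0 f = 0 := by
  ext1 x; simp [sectionAct]

theorem sectionAct_zero_right (s : ∀ x, ℰ.Stalk x) : ℰ.sectionAct s 0 = 0 := by
  ext1 x; simp [sectionAct]

theorem sectionAct_charFun_of_mem (s : ∀ x, ℰ.Stalk x) (U : 𝒢.CompactBisection) {x : X}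
    (g : {g : G // 𝒢.d g = x}) (hg : g.1 ∈ U.carrier) :
    ℰ.sectionAct s (charFun 𝕜 U.carrier) x = ℰ.move g (s (𝒢.r g.1)) := by
  unfold sectionAct
  rw [finsum_eq_single _ g, charFun_of_mem hg, one_smul]
  intro h hne
  rw [charFun_of_notMem, zero_smul]
  exact fun hh => hne (Subtype.ext (U.injOn_d hh hg (h.2.trans g.2.symm)))

theorem sectionAct_charFun_of_notMem (s : ∀ x, ℰ.Stalk x) (U : 𝒢.CompactBisection) {x : X}
    (hx : x ∉ 𝒢.d '' U.carrier) : ℰ.sectionAct s (charFun 𝕜 U.carrier) x = 0 := by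
  refine finsum_eq_zero_of_forall_eq_zero fun g => ?_
  rw [charFun_of_notMem, zero_smul]
  exact fun hg => hx ⟨g.1, hg, g.2⟩

theorem stalk_ext {x : X} {a b : ℰ.Stalk x} (h : a.1 = b.1) : a = b := Subtype.ext h

theorem move_congr {x y : X} (s : ∀ x, ℰ.Stalk x) (g : {g : G // 𝒢.d g = x})
    (h : {g : G // 𝒢.d g = y}) (e : g.1 = h.1) :
    (ℰ.move g (s (𝒢.r g.1))).1 = (ℰ.move h (s (𝒢.r h.1))).1 := by
  obtain ⟨g, rfl⟩ := g
  obtain ⟨h, rfl⟩ := h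
  cases e
  rfl

theorem sectionAct_charFun_charFun [𝒢.IsAmple] (s : ∀ x, ℰ.Stalk x)
    (U V : 𝒢.CompactBisection) :
    ℰ.sectionAct (ℰ.sectionAct s (charFun 𝕜 U.carrier)) (charFun 𝕜 V.carrier) =
      ℰ.sectionAct s (charFun 𝕜 (U.mul V).carrier) := by
  ext1 x
  by_cases hx : x ∈ 𝒢.d '' V.carrier
  · obtain ⟨h, hh, rfl⟩ := hx
    rw [ℰ.sectionAct_charFun_of_mem _ V ⟨h, rfl⟩ hh]
    by_cases hy : 𝒢.r h ∈ 𝒢.d '' U.carrier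
    · obtain ⟨g, hg, hgh⟩ := hy
      rw [ℰ.sectionAct_charFun_of_mem s U ⟨g, hgh⟩ hg,
        ℰ.sectionAct_charFun_of_mem s (U.mul V) ⟨𝒢.mul g h hgh, 𝒢.d_mul g h hgh⟩
          ⟨g, hg, h, hh, hgh, rfl⟩]
      refine ℰ.stalk_ext ?_
      have h1 := ℰ.act_act (s (𝒢.r g)).1 g h (s (𝒢.r g)).2 hgh
      refine h1.trans ?_
      have : ∀ y (e : y = 𝒢.r g) (a : ℰ.p (s (𝒢.r g)).1 = _) (b : ℰ.p (s y).1 = _),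
          ℰ.act (s (𝒢.r g)).1 (𝒢.mul g h hgh) a = ℰ.act (s y).1 (𝒢.mul g h hgh) b := by
        rintro y rfl a b; rfl
      exact this _ (𝒢.r_mul g h hgh) _ _
    · rw [ℰ.sectionAct_charFun_of_notMem s U hy, map_zero]
      symm
      apply ℰ.sectionAct_charFun_of_notMem
      rintro ⟨_, ⟨g, hg, h', hh', p, rfl⟩, e⟩
      obtain rfl := V.injOn_d hh' hh ((𝒢.d_mul g h' p).symm.trans e)
      exact hy ⟨g, hg, p⟩
  · rw [ℰ.sectionAct_charFun_of_notMem _ V hx, ℰ.sectionAct_charFun_of_notMem]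
    rintro ⟨_, ⟨g, hg, h, hh, p, rfl⟩, e⟩
    exact hx ⟨h, hh, (𝒢.d_mul g h p).symm.trans e⟩

theorem isOpen_setOf_eq {s t : ∀ x, ℰ.Stalk x} (hs : Continuous fun x => (s x).1)
    (ht : Continuous fun x => (t x).1) : IsOpen {x | s x = t x} := by
  have := ℰ.isLocalHomeomorph_p.isLocallyInjective.isOpen_eqLocus hs ht
    (funext fun x => (s x).2.trans (t x).2.symm)
  convert this using 3
  exact Subtype.ext_iff

theorem isClosed_support {s : ∀ x, ℰ.Stalk x} (hs : Continuous fun x => (s x).1) :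
    IsClosed {x | s x ≠ 0} :=
  (ℰ.isOpen_setOf_eq (t := 0) hs ℰ.continuous_zero).isClosed_compl

theorem add_val {x : X} (a b : ℰ.Stalk x) :
    (a + b).1 = (ℰ.toStalk a.1 (a.2.trans b.2.symm) + ℰ.toStalk b.1 rfl).1 := by
  obtain ⟨b, rfl⟩ := b; rfl

theorem smul_val {x : X} (c : 𝕜) (a : ℰ.Stalk x) :
    (c • a).1 = (c • ℰ.toStalk a.1 rfl).1 := by
  obtain ⟨a, rfl⟩ := a; rfl

theorem continuous_section_add {s t : ∀ x, ℰ.Stalk x} (hs : Continuous fun x => (s x).1)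
    (ht : Continuous fun x => (t x).1) : Continuous fun x => ((s + t) x).1 := by
  have h := ℰ.continuous_add.comp (f := fun x => (⟨((s x).1, (t x).1),
    (s x).2.trans (t x).2.symm⟩ : {q : ℰ.E × ℰ.E // ℰ.p q.1 = ℰ.p q.2}))
    ((hs.prodMk ht).subtype_mk _)
  convert h using 2 with x
  exact ℰ.add_val (s x) (t x)

theorem continuous_section_smul (c : 𝕜) {s : ∀ x, ℰ.Stalk x}
    (hs : Continuous fun x => (s x).1) : Continuous fun x => ((c • s) x).1 := by
  convert (ℰ.continuous_smul c).comp hs using 2 with x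
  exact ℰ.smul_val c (s x)

/-- The `𝕜`-module of compactly supported global sections: a section of `p` is a choice of a point
in each stalk, depending continuously on the base point. The support `{x | s x ≠ 0}` of a section is
automatically closed. -/
def sections : Submodule 𝕜 (∀ x, ℰ.Stalk x) where
  carrier := {s | Continuous (fun x => (s x).1) ∧ IsCompact {x | s x ≠ 0}}
  zero_mem' := ⟨ℰ.continuous_zero, by simp⟩
  add_mem' := by
    rintro s t ⟨hs, hs'⟩ ⟨ht, ht'⟩
    have h := ℰ.continuous_section_add hs ht
    refine ⟨h, (hs'.union ht').of_isClosed_subset (ℰ.isClosed_support h) fun x hx => ?_⟩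
    by_contra hn
    simp only [Set.mem_union, Set.mem_ofPred_eq, not_or, not_not] at hn
    exact hx (by simp [hn.1, hn.2])
  smul_mem' := by
    rintro c s ⟨hs, hs'⟩
    have h := ℰ.continuous_section_smul c hs
    refine ⟨h, hs'.of_isClosed_subset (ℰ.isClosed_support h) fun x hx hn => hx ?_⟩
    rw [Pi.smul_apply, hn, smul_zero]

variable [𝒢.IsAmple]

theorem sectionAct_charFun_mem_sections {s : ∀ x, ℰ.Stalk x} (hs : s ∈ ℰ.sections)
    (U : 𝒢.CompactBisection) : ℰ.sectionAct s (charFun 𝕜 U.carrier) ∈ ℰ.sections := by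
  have := IsAmple.t2Space (𝒢 := 𝒢)
  have hcont : Continuous fun x => (ℰ.sectionAct s (charFun 𝕜 U.carrier) x).1 := by
    rw [← continuousOn_univ, ← Set.union_compl_self (𝒢.d '' U.carrier)]
    refine ContinuousOn.union_of_isOpen ?_ ?_ U.isOpen_image_d
      (U.dom.isCompact.isClosed.isOpen_compl)
    · rw [continuousOn_iff_continuous_domRestrict]
      obtain ⟨σ, hσ, hσU⟩ := U.exists_section
      have h := ℰ.continuous_act.comp (f := fun x : 𝒢.d '' U.carrier =>
        (⟨((s (𝒢.r (σ x))).1, σ x), (s (𝒢.r (σ x))).2⟩ :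
          {q : ℰ.E × G // ℰ.p q.1 = 𝒢.r q.2}))
        (((hs.1.comp (𝒢.continuous_r.comp hσ)).prodMk hσ).subtype_mk _)
      convert h using 1
      refine funext fun x => congrArg Subtype.val
        (ℰ.sectionAct_charFun_of_mem s U ⟨σ x, (hσU x).2⟩ (hσU x).1)
    · refine ℰ.continuous_zero.continuousOn.congr fun x hx => ?_
      exact congrArg Subtype.val (ℰ.sectionAct_charFun_of_notMem s U hx)
  refine ⟨hcont, U.dom.isCompact.of_isClosed_subset (ℰ.isClosed_support hcont) fun x hx => ?_⟩
  by_contra hn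
  exact hx (ℰ.sectionAct_charFun_of_notMem s U hn)

theorem sectionAct_mem_sections {s : ∀ x, ℰ.Stalk x} (hs : s ∈ ℰ.sections) {f : G → 𝕜}
    (hf : f ∈ algebraSubmodule 𝒢 𝕜) : ℰ.sectionAct s f ∈ ℰ.sections := by
  induction hf using Submodule.span_induction with
  | mem f hf =>
    obtain ⟨U, rfl⟩ := hf
    exact ℰ.sectionAct_charFun_mem_sections hs U
  | zero => rw [sectionAct_zero_right]; exact zero_mem _
  | add f k hf hk h h' => rw [sectionAct_add_right ℰ _ hf hk]; exact add_mem h h'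
  | smul c f hf h => rw [sectionAct_smul_right ℰ c _ hf]; exact Submodule.smul_mem _ _ h

theorem sectionAct_mul (s : ∀ x, ℰ.Stalk x) (a b : GroupoidAlgebra 𝒢 𝕜) :
    ℰ.sectionAct s (a * b).1 = ℰ.sectionAct (ℰ.sectionAct s a.1) b.1 := by
  have hadd : ∀ a b : GroupoidAlgebra 𝒢 𝕜, (a + b).1 = a.1 + b.1 := fun _ _ => rfl
  have hsm : ∀ (c : 𝕜) (a : GroupoidAlgebra 𝒢 𝕜), (c • a).1 = c • a.1 := fun _ _ => rfl
  have h0 : (0 : GroupoidAlgebra 𝒢 𝕜).1 = 0 := rfl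
  induction a using GroupoidAlgebra.induction with
  | chi U =>
    induction b using GroupoidAlgebra.induction with
    | chi V =>
      rw [GroupoidAlgebra.chi_mul_chi]
      exact (ℰ.sectionAct_charFun_charFun s U V).symm
    | zero => rw [mul_zero, h0, sectionAct_zero_right, sectionAct_zero_right]
    | add a b ha hb =>
      rw [mul_add, hadd, hadd, sectionAct_add_right ℰ _ (GroupoidAlgebra.mem _) (GroupoidAlgebra.mem _),
        sectionAct_add_right ℰ _ a.2 b.2, ha, hb]
    | smul c a ha =>
      rw [mul_smul_comm, hsm, hsm, sectionAct_smul_right ℰ _ _ (GroupoidAlgebra.mem _),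
        sectionAct_smul_right ℰ _ _ a.2, ha]
  | zero => rw [zero_mul, h0, sectionAct_zero_right, sectionAct_zero_left]
  | add a a' ha hb =>
    rw [add_mul, hadd, hadd, sectionAct_add_right ℰ _ (GroupoidAlgebra.mem _) (GroupoidAlgebra.mem _),
      sectionAct_add_right ℰ _ a.2 a'.2, sectionAct_add_left ℰ _ _ b.2, ha, hb]
  | smul c a ha =>
    rw [smul_mul_assoc, hsm, hsm, sectionAct_smul_right ℰ _ _ (GroupoidAlgebra.mem _),
      sectionAct_smul_right ℰ _ _ a.2, sectionAct_smul_left ℰ _ _ b.2, ha]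

theorem sectionAct_chiUnits {s : ∀ x, ℰ.Stalk x} (W : TopologicalSpace.CompactOpens X)
    (h : ∀ x, s x ≠ 0 → x ∈ W) :
    ℰ.sectionAct s (GroupoidAlgebra.chiUnits (𝒢 := 𝒢) (𝕜 := 𝕜) W).1 = s := by
  ext1 x
  by_cases hx : x ∈ W
  · refine (ℰ.sectionAct_charFun_of_mem s (CompactBisection.ofUnits W)
      ⟨𝒢.unit x, 𝒢.d_unit x⟩ ⟨x, hx, rfl⟩).trans (ℰ.stalk_ext ?_)
    have : ∀ y (e : y = x) (g : G) (hg : g = 𝒢.unit x) (p : ℰ.p (s y).1 = 𝒢.r g),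
        ℰ.act (s y).1 g p = (s x).1 := by
      rintro y rfl g rfl p
      have h1 := ℰ.act_unit (s y).1
      have h2 : 𝒢.unit (ℰ.p (s y).1) = 𝒢.unit y := congrArg _ (s y).2
      refine Eq.trans ?_ h1
      congr 1
      exact h2.symm
    exact this _ (𝒢.r_unit x) _ rfl _
  · have h0 : s x = 0 := by_contra fun hn => hx (h x hn)
    rw [h0]
    refine ℰ.sectionAct_charFun_of_notMem s (CompactBisection.ofUnits W) ?_
    rintro ⟨_, ⟨y, hy, rfl⟩, e⟩
    rw [𝒢.d_unit] at e
    exact hx (e ▸ hy)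

theorem exists_compactOpens_of_isCompact (𝒢 : TopologicalGroupoid X G) [𝒢.IsAmple] {K : Set X}
    (hK : IsCompact K) : ∃ W : TopologicalSpace.CompactOpens X, K ⊆ W := by
  refine hK.induction_on ⟨⊥, Set.empty_subset _⟩ (fun s t h ht => ht.imp fun W hW => h.trans hW)
    (fun s t hs ht => ?_) fun x _ => ?_
  · obtain ⟨V, hV⟩ := hs
    obtain ⟨W, hW⟩ := ht
    exact ⟨V ⊔ W, Set.union_subset_union hV hW⟩
  · obtain ⟨W, hW, -⟩ := 𝒢.exists_compactOpens isOpen_univ (Set.mem_univ x)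
    exact ⟨W, mem_nhdsWithin_of_mem_nhds (W.isOpen.mem_nhds hW), W, subset_rfl⟩

/-- The unitary right `𝕜𝒢`-module `Γ_c(E, p)` of compactly supported global sections. -/
def gammaObj : UnitaryRightModule.{max v w, max u e} (GroupoidAlgebra 𝒢 𝕜) where
  carrier := ℰ.sections
  act := AddMonoidHom.mk' (fun s => AddMonoidHom.mk'
      (fun f => ⟨ℰ.sectionAct s.1 f.1, ℰ.sectionAct_mem_sections s.2 f.2⟩)
      fun a b => Subtype.ext (ℰ.sectionAct_add_right s.1 a.2 b.2))
    fun s t => by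
      ext1 f
      exact Subtype.ext (ℰ.sectionAct_add_left s.1 t.1 f.2)
  act_mul s a b := Subtype.ext (ℰ.sectionAct_mul s.1 a b)
  unitary := by
    rw [eq_top_iff]
    rintro s -
    obtain ⟨W, hW⟩ := exists_compactOpens_of_isCompact 𝒢 s.2.2
    exact AddSubgroup.subset_closure ⟨(s, GroupoidAlgebra.chiUnits W),
      Subtype.ext (ℰ.sectionAct_chiUnits W fun x hx => hW hx)⟩

/-- The action of a morphism on sections, `s ↦ φ ∘ s`. -/
def gammaMap {ℰ ℱ : ModuleSheaf.{u, v, w, e} 𝒢 𝕜} (φ : ModuleSheaf.Hom ℰ ℱ) :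
    UnitaryRightModule.Hom ℰ.gammaObj ℱ.gammaObj where
  toAddMonoidHom := AddMonoidHom.mk'
    (fun s : ℰ.sections => (⟨fun x => φ.stalkMap x (s.1 x), φ.continuous_toFun.comp s.2.1, by
      have h : Continuous fun x => (φ.stalkMap x (s.1 x)).1 := φ.continuous_toFun.comp s.2.1
      refine s.2.2.of_isClosed_subset (ℱ.isClosed_support h) fun x hx hn => hx ?_
      have := φ.map_smul x 0 0
      rw [zero_smul, zero_smul] at this
      exact (congrArg _ hn).trans this⟩ : ℱ.sections))
    fun s t => Subtype.ext (funext fun x => φ.map_add x (s.1 x) (t.1 x))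
  map_act s f := by
    refine Subtype.ext (funext fun x => ?_)
    let L : ℰ.Stalk x →ₗ[𝕜] ℱ.Stalk x := ⟨⟨φ.stalkMap x, φ.map_add x⟩, φ.map_smul x⟩
    change L (∑ᶠ g : {g : G // 𝒢.d g = x}, f.1 g.1 • ℰ.move g (s.1 (𝒢.r g.1))) =
      ∑ᶠ g : {g : G // 𝒢.d g = x}, f.1 g.1 • ℱ.move g (φ.stalkMap _ (s.1 (𝒢.r g.1)))
    refine (L.toAddMonoidHom.map_finsum (ℰ.sectionAct_finite s.1 f.mem x)).trans ?_
    refine finsum_congr fun g => ?_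
    refine (L.map_smul _ _).trans (congrArg _ (Subtype.ext ?_))
    exact φ.map_act _ _ _

end ModuleSheaf

/-- The functor `Γ_c` from `𝒢`-sheaves of `𝕜`-modules to unitary right `𝕜𝒢`-modules. -/
def gammaFunctor (𝒢 : TopologicalGroupoid X G) [𝒢.IsAmple] (𝕜 : Type w) [CommRing 𝕜] :
    ModuleSheaf.{u, v, w, e} 𝒢 𝕜 ⥤
      UnitaryRightModule.{max v w, max u e} (GroupoidAlgebra 𝒢 𝕜) where
  obj ℰ := ℰ.gammaObj
  map φ := ModuleSheaf.gammaMap φ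

end

noncomputable section

namespace Sh

open GroupoidAlgebra

variable {𝒢 : TopologicalGroupoid X G} [𝒢.IsAmple] {𝕜 : Type w} [CommRing 𝕜]
  (M : UnitaryRightModule.{max v w, m} (GroupoidAlgebra 𝒢 𝕜))

theorem act_of_le {n : M.carrier} {V W : TopologicalSpace.CompactOpens X} (h : V ≤ W)
    (hn : M.act n (chiUnits V) = n) : M.act n (chiUnits W) = n := by
  rw [← hn, ← M.act_mul, chiUnits_mul_of_le h]

theorem exists_act_chiUnits (n : M.carrier) :
    ∃ W : TopologicalSpace.CompactOpens X, M.act n (chiUnits W) = n := by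
  have h : n ∈ AddSubgroup.closure (Set.range fun q : M.carrier × GroupoidAlgebra 𝒢 𝕜 =>
      M.act q.1 q.2) := by rw [M.unitary]; trivial
  induction h using AddSubgroup.closure_induction with
  | mem n hn =>
    obtain ⟨⟨n, a⟩, rfl⟩ := hn
    obtain ⟨W, hW⟩ := exists_mul_chiUnits a
    exact ⟨W, by rw [← M.act_mul, hW]⟩
  | zero => exact ⟨⊥, by simp⟩
  | add n n' _ _ h h' =>
    obtain ⟨V, hV⟩ := h
    obtain ⟨W, hW⟩ := h'
    exact ⟨V ⊔ W, by rw [map_add, AddMonoidHom.add_apply, act_of_le M le_sup_left hV,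
      act_of_le M le_sup_right hW]⟩
  | neg n _ h =>
    obtain ⟨V, hV⟩ := h
    exact ⟨V, by rw [map_neg, AddMonoidHom.neg_apply, hV]⟩

/-- The scalar multiplication of a unitary module: `cm = m(ce)` for an idempotent `e` with
`me = m`; see `smul_eq`. -/
instance : SMul 𝕜 M.carrier :=
  ⟨fun c n => M.act n (c • chiUnits (exists_act_chiUnits M n).choose)⟩

theorem smul_eq_of_chiUnits (c : 𝕜) {n : M.carrier} {W : TopologicalSpace.CompactOpens X}
    (h : M.act n (chiUnits W) = n) : c • n = M.act n (c • chiUnits W) := by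
  obtain ⟨V, hV⟩ : ∃ V, V = (exists_act_chiUnits M n).choose := ⟨_, rfl⟩
  have hn := (exists_act_chiUnits M n).choose_spec
  rw [← hV] at hn
  change M.act n (c • chiUnits (exists_act_chiUnits M n).choose) = _
  rw [← hV]
  obtain ⟨Z, hZ⟩ := 𝒢.exists_compactOpens_inf V W
  have h1 : M.act n (c • chiUnits V) = M.act n (c • chiUnits Z) := by
    conv_lhs => rw [← h, ← M.act_mul, mul_smul_comm,
      chiUnits_mul_chiUnits W V Z (hZ.trans (Set.inter_comm _ _))]
  have h2 : M.act n (c • chiUnits W) = M.act n (c • chiUnits Z) := by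
    conv_lhs => rw [← hn, ← M.act_mul, mul_smul_comm, chiUnits_mul_chiUnits V W Z hZ]
  rw [h1, h2]

theorem smul_eq (c : 𝕜) {n : M.carrier} {a : GroupoidAlgebra 𝒢 𝕜} (h : M.act n a = n) :
    c • n = M.act n (c • a) := by
  obtain ⟨W, hW⟩ := exists_mul_chiUnits a
  have h1 : M.act n (chiUnits W) = n := by rw [← h, ← M.act_mul, hW]
  rw [smul_eq_of_chiUnits M c h1]
  conv_lhs => rw [← h, ← M.act_mul, mul_smul_comm, hW]

theorem act_smul (c : 𝕜) (n : M.carrier) (a : GroupoidAlgebra 𝒢 𝕜) :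
    M.act n (c • a) = c • M.act n a := by
  obtain ⟨W, hW⟩ := exists_mul_chiUnits a
  have h1 : M.act (M.act n a) (chiUnits W) = M.act n a := by rw [← M.act_mul, hW]
  rw [smul_eq_of_chiUnits M c h1, ← M.act_mul, mul_smul_comm, hW]

instance : Module 𝕜 M.carrier where
  one_smul n := by
    obtain ⟨W, hW⟩ := exists_act_chiUnits M n
    rw [smul_eq M 1 hW, one_smul, hW]
  mul_smul c c' n := by
    obtain ⟨W, hW⟩ := exists_act_chiUnits M n
    rw [smul_eq M (c * c') hW, smul_eq M c' hW, mul_smul, act_smul]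
  smul_zero c := by rw [smul_eq M c (a := 0) (map_zero _), smul_zero, map_zero]
  zero_smul n := by
    obtain ⟨W, hW⟩ := exists_act_chiUnits M n
    rw [smul_eq M 0 hW, zero_smul, map_zero]
  smul_add c n n' := by
    obtain ⟨V, hV⟩ := exists_act_chiUnits M n
    obtain ⟨W, hW⟩ := exists_act_chiUnits M n'
    have hV' := act_of_le M (le_sup_left : V ≤ V ⊔ W) hV
    have hW' := act_of_le M (le_sup_right : W ≤ V ⊔ W) hW
    rw [smul_eq M c hV', smul_eq M c hW', smul_eq M c (n := n + n') (a := chiUnits (V ⊔ W)),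
      map_add, AddMonoidHom.add_apply]
    rw [map_add, AddMonoidHom.add_apply, hV', hW']
  add_smul c c' n := by
    obtain ⟨W, hW⟩ := exists_act_chiUnits M n
    rw [smul_eq M (c + c') hW, smul_eq M c hW, smul_eq M c' hW, add_smul, map_add]

theorem smul_act (c : 𝕜) (n : M.carrier) (a : GroupoidAlgebra 𝒢 𝕜) :
    M.act (c • n) a = c • M.act n a := by
  obtain ⟨W, hW⟩ := exists_act_chiUnits M n
  rw [smul_eq M c hW, ← M.act_mul, smul_mul_assoc, act_smul, M.act_mul, hW]

/-- The `𝕜`-linear map `m ↦ ma`. -/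
def actLin (a : GroupoidAlgebra 𝒢 𝕜) : M.carrier →ₗ[𝕜] M.carrier where
  toFun n := M.act n a
  map_add' n n' := by rw [map_add, AddMonoidHom.add_apply]
  map_smul' c n := smul_act M c n a

/-- The `𝕜`-submodule `M(W) = Mχ_W`. -/
def part (W : TopologicalSpace.CompactOpens X) : Submodule 𝕜 M.carrier :=
  LinearMap.range (actLin M (chiUnits W))

/-- The restriction map `M(V) → M(W)`, `m ↦ mχ_W`. -/
def rho (V W : TopologicalSpace.CompactOpens X) : part M V →ₗ[𝕜] part M W :=
  ((actLin M (chiUnits W)).comp (part M V).subtype).codRestrict (part M W) fun n => ⟨n, rfl⟩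

/-- The compact open neighbourhoods of `x`, ordered by reverse inclusion. -/
abbrev Nbhd (x : X) : Type u := {W : TopologicalSpace.CompactOpens X // x ∈ W}ᵒᵈ

/-- The compact open set underlying an index of the direct limit. -/
def Nbhd.set {x : X} (W : Nbhd x) : TopologicalSpace.CompactOpens X := (OrderDual.ofDual W).1

theorem Nbhd.mem {x : X} (W : Nbhd x) : x ∈ W.set := (OrderDual.ofDual W).2

/-- A compact open neighbourhood, as an index of the direct limit. -/
def Nbhd.mk {x : X} (W : TopologicalSpace.CompactOpens X) (h : x ∈ W) : Nbhd x :=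
  OrderDual.toDual ⟨W, h⟩

instance (x : X) : DecidableEq (Nbhd x) := Classical.decEq _

/-- The stalk `M_x = lim M(W)`, the direct limit over the compact open neighbourhoods `W` of `x`
along the maps `rho`. -/
def Stalk (x : X) : Type (max u m) :=
  Module.DirectLimit (R := 𝕜) (ι := Nbhd x) (fun W => part M W.set)
    (fun V W _ => rho M V.set W.set)

instance (x : X) : AddCommGroup (Stalk M x) :=
  inferInstanceAs (AddCommGroup (Module.DirectLimit (R := 𝕜) (ι := Nbhd x)
    (fun W => part M W.set) (fun V W _ => rho M V.set W.set)))

instance (x : X) : Module 𝕜 (Stalk M x) :=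
  inferInstanceAs (Module 𝕜 (Module.DirectLimit (R := 𝕜) (ι := Nbhd x)
    (fun W => part M W.set) (fun V W _ => rho M V.set W.set)))

/-- The canonical map `M(W) → M_x`, for `x ∈ W`. -/
def Stalk.of {x : X} (W : Nbhd x) : part M W.set →ₗ[𝕜] Stalk M x :=
  Module.DirectLimit.of 𝕜 (Nbhd x) (fun W => part M W.set) (fun V W _ => rho M V.set W.set) W

theorem rho_val (V W : TopologicalSpace.CompactOpens X) (n : part M V) :
    (rho M V W n).1 = M.act n.1 (chiUnits W) := rfl

/-- The element `mχ_W` of `M(W)`. -/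
def toPart (W : TopologicalSpace.CompactOpens X) : M.carrier →ₗ[𝕜] part M W :=
  (actLin M (chiUnits W)).rangeRestrict

theorem toPart_val (W : TopologicalSpace.CompactOpens X) (n : M.carrier) :
    (toPart M W n).1 = M.act n (chiUnits W) := rfl

theorem Nbhd.set_le {x : X} {V W : Nbhd x} (h : V ≤ W) : W.set ≤ V.set := h

theorem act_part {W : TopologicalSpace.CompactOpens X} (n : part M W) :
    M.act n.1 (chiUnits W) = n.1 := by
  obtain ⟨_, n, rfl⟩ := n
  change M.act (M.act n _) _ = M.act n _
  rw [← M.act_mul, chiUnits_mul_of_le le_rfl]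

theorem rho_toPart {V W : TopologicalSpace.CompactOpens X} (h : W ≤ V) (n : M.carrier) :
    rho M V W (toPart M V n) = toPart M W n := by
  refine Subtype.ext ?_
  rw [rho_val, toPart_val, toPart_val, ← M.act_mul, chiUnits_mul_of_ge h]

theorem Stalk.of_rho {x : X} {V W : Nbhd x} (h : V ≤ W) (n : part M V.set) :
    Stalk.of M W (rho M V.set W.set n) = Stalk.of M V n :=
  Module.DirectLimit.of_f (hij := h)

theorem Nbhd.exists_ge (𝒢 : TopologicalGroupoid X G) [𝒢.IsAmple] {x : X} (V W : Nbhd x) :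
    ∃ Z : Nbhd x, V ≤ Z ∧ W ≤ Z := by
  obtain ⟨Z, hZ⟩ := 𝒢.exists_compactOpens_inf V.set W.set
  have hx : x ∈ Z := show x ∈ (Z : Set X) by rw [hZ]; exact ⟨V.mem, W.mem⟩
  exact ⟨Nbhd.mk Z hx, show (Z : Set X) ⊆ V.set by rw [hZ]; exact Set.inter_subset_left,
    show (Z : Set X) ⊆ W.set by rw [hZ]; exact Set.inter_subset_right⟩

theorem Nbhd.nonempty (𝒢 : TopologicalGroupoid X G) [𝒢.IsAmple] (x : X) : Nonempty (Nbhd x) := by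
  obtain ⟨W, hW, -⟩ := 𝒢.exists_compactOpens isOpen_univ (Set.mem_univ x)
  exact ⟨Nbhd.mk W hW⟩

theorem Stalk.of_toPart {x : X} (V W : Nbhd x) (n : M.carrier) :
    Stalk.of M V (toPart M V.set n) = Stalk.of M W (toPart M W.set n) := by
  obtain ⟨Z, hV, hW⟩ := Nbhd.exists_ge 𝒢 V W
  rw [← Stalk.of_rho M hV, ← Stalk.of_rho M hW, rho_toPart M (Nbhd.set_le hV),
    rho_toPart M (Nbhd.set_le hW)]

/-- The map `M → M_x`, `m ↦ [m]_x`: the class of `mχ_W` for any compact open neighbourhood `W` of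
`x`, hence the class of `m` itself if `m ∈ M(W)`; see `of_eq_germ`. -/
def germ (x : X) : M.carrier →ₗ[𝕜] Stalk M x :=
  (Stalk.of M (Nbhd.nonempty 𝒢 x).some).comp (toPart M (Nbhd.nonempty 𝒢 x).some.set)

theorem of_toPart_eq_germ {x : X} (W : Nbhd x) (n : M.carrier) :
    Stalk.of M W (toPart M W.set n) = germ M x n := Stalk.of_toPart M _ _ n

theorem of_eq_germ {x : X} (W : Nbhd x) (n : part M W.set) :
    Stalk.of M W n = germ M x n.1 := by
  rw [← of_toPart_eq_germ M W]
  exact congrArg _ (Subtype.ext (act_part M n).symm)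

theorem germ_act_chiUnits {x : X} {W : TopologicalSpace.CompactOpens X} (hx : x ∈ W)
    (n : M.carrier) : germ M x (M.act n (chiUnits W)) = germ M x n := by
  rw [← of_toPart_eq_germ M (Nbhd.mk W hx) n]
  exact (of_eq_germ M (Nbhd.mk W hx) (toPart M W n)).symm

theorem germ_surjective (x : X) : Function.Surjective (germ M x) := by
  intro z
  have := Nbhd.nonempty 𝒢 x
  have : IsDirectedOrder (Nbhd x) := ⟨fun V W => Nbhd.exists_ge 𝒢 V W⟩
  obtain ⟨W, n, rfl⟩ := Module.DirectLimit.exists_of z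
  exact ⟨n.1, (of_eq_germ M W n).symm⟩

theorem germ_eq_zero {x : X} {n : M.carrier} (h : germ M x n = 0) :
    ∃ W : TopologicalSpace.CompactOpens X, x ∈ W ∧ M.act n (chiUnits W) = 0 := by
  have : IsDirectedOrder (Nbhd x) := ⟨fun V W => Nbhd.exists_ge 𝒢 V W⟩
  have : DirectedSystem (fun W : Nbhd x => part M W.set)
      (fun V W _ => rho M V.set W.set) := by
    refine ⟨fun W n => Subtype.ext (act_part M n), fun V W Z h h' n => Subtype.ext ?_⟩
    change M.act (M.act n.1 _) _ = M.act n.1 _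
    rw [← M.act_mul, chiUnits_mul_of_ge (Nbhd.set_le h')]
  obtain ⟨Z, hZ, e⟩ := Module.DirectLimit.of.zero_exact h
  refine ⟨Z.set, Z.mem, ?_⟩
  have e' := congrArg Subtype.val e
  rwa [rho_toPart M (Nbhd.set_le hZ)] at e'

theorem germ_eq_iff {x : X} {n n' : M.carrier} : germ M x n = germ M x n' ↔
    ∃ W : TopologicalSpace.CompactOpens X,
      x ∈ W ∧ M.act n (chiUnits W) = M.act n' (chiUnits W) := by
  constructor
  · intro h
    obtain ⟨W, hx, hW⟩ := germ_eq_zero M (n := n - n') (by rw [map_sub, h, sub_self])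
    exact ⟨W, hx, by rwa [map_sub, AddMonoidHom.sub_apply, sub_eq_zero] at hW⟩
  · rintro ⟨W, hx, hW⟩
    rw [← germ_act_chiUnits M hx n, hW, germ_act_chiUnits M hx]

theorem germ_act_congr {g : G} {U V : 𝒢.CompactBisection} (hU : g ∈ U.carrier)
    (hV : g ∈ V.carrier) {n n' : M.carrier} (h : germ M (𝒢.r g) n = germ M (𝒢.r g) n') :
    germ M (𝒢.d g) (M.act n (chi U)) = germ M (𝒢.d g) (M.act n' (chi V)) := by
  obtain ⟨W, hx, hW⟩ := (germ_eq_iff M).1 h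
  obtain ⟨Z, hgZ, hZ⟩ := 𝒢.exists_compactBisection
    ((U.isOpen.inter V.isOpen).inter (W.isOpen.preimage 𝒢.continuous_r)) ⟨⟨hU, hV⟩, hx⟩
  have key : ∀ Y : 𝒢.CompactBisection, Z.carrier ⊆ Y.carrier →
      (chi Y * chiUnits Z.dom : GroupoidAlgebra 𝒢 𝕜) = chi Z := by
    intro Y hY
    refine chi_mul_chiUnits _ _ _ ?_
    ext k
    refine ⟨fun hk => ⟨hY hk, k, hk, rfl⟩, ?_⟩
    rintro ⟨hk, l, hl, e⟩
    rwa [← Y.injOn_d (hY hl) hk e]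
  have key' : (chiUnits W * chi Z : GroupoidAlgebra 𝒢 𝕜) = chi Z := by
    refine chiUnits_mul_chi _ _ _ ?_
    ext k
    exact ⟨fun hk => ⟨hk, (hZ hk).2⟩, fun hk => hk.1⟩
  refine (germ_eq_iff M).2 ⟨Z.dom, ⟨g, hgZ, rfl⟩, ?_⟩
  rw [← M.act_mul, ← M.act_mul, key U fun k hk => (hZ hk).1.1, key V fun k hk => (hZ hk).1.2,
    ← key', M.act_mul, hW, M.act_mul]

/-- A compact open local bisection containing `g`. -/
def bisectionAt (g : G) : 𝒢.CompactBisection :=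
  (𝒢.exists_compactBisection isOpen_univ (Set.mem_univ g)).choose

theorem mem_bisectionAt (g : G) : g ∈ (bisectionAt (𝒢 := 𝒢) g).carrier :=
  (𝒢.exists_compactBisection isOpen_univ (Set.mem_univ g)).choose_spec.1

/-- The map `R_g : M_{r(g)} → M_{d(g)}`, `[m] ↦ [mχ_U]`, where `U` is a compact open local
bisection containing `g`; see `R_germ`. -/
def R (g : G) : Stalk M (𝒢.r g) →ₗ[𝕜] Stalk M (𝒢.d g) :=
  Module.DirectLimit.lift 𝕜 (Nbhd (𝒢.r g)) (fun W => part M W.set)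
    (fun V W _ => rho M V.set W.set)
    (fun W => (germ M (𝒢.d g)).comp ((actLin M (chi (bisectionAt g))).comp (part M W.set).subtype))
    fun _ W _ n => germ_act_congr M (mem_bisectionAt g) (mem_bisectionAt g)
      (germ_act_chiUnits M W.mem n.1)

theorem R_germ {g : G} {U : 𝒢.CompactBisection} (hU : g ∈ U.carrier) (n : M.carrier) :
    R M g (germ M (𝒢.r g) n) = germ M (𝒢.d g) (M.act n (chi U)) := by
  refine (Module.DirectLimit.lift_of _ _ _).trans ?_
  exact germ_act_congr M (mem_bisectionAt g) hU
    (germ_act_chiUnits M (Nbhd.mem (x := 𝒢.r g) _) n)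

/-- The total space `∐ M_x`. -/
def Tot : Type (max u m) := Σ x : X, Stalk M x

/-- The point `[n]_x` of the total space. -/
def pt (n : M.carrier) (x : X) : Tot M := ⟨x, germ M x n⟩

/-- The topology of the total space is generated by the sets `(W, n) = {[n]_x | x ∈ W}`, for `W`
compact open. -/
instance : TopologicalSpace (Tot M) :=
  TopologicalSpace.generateFrom {B | ∃ (W : TopologicalSpace.CompactOpens X) (n : M.carrier),
    B = pt M n '' W}

variable {M} in
theorem exists_pt (a : Tot M) : ∃ n, a = pt M n a.1 := by
  obtain ⟨x, s⟩ := a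
  obtain ⟨n, rfl⟩ := germ_surjective M x s
  exact ⟨n, rfl⟩

theorem pt_eq_pt {n n' : M.carrier} {x : X} :
    pt M n x = pt M n' x ↔ germ M x n = germ M x n' :=
  ⟨fun h => eq_of_heq (Sigma.mk.inj h).2, fun h => by rw [pt, h]; rfl⟩

theorem isOpen_basic (n : M.carrier) (W : TopologicalSpace.CompactOpens X) :
    IsOpen (pt M n '' W) := TopologicalSpace.isOpen_generateFrom_of_mem ⟨W, n, rfl⟩

theorem pt_mem_nhds (n : M.carrier) {x : X} {O : Set X} (hO : IsOpen O) (hx : x ∈ O) :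
    pt M n '' O ∈ 𝓝 (pt M n x) := by
  obtain ⟨W, hxW, hW⟩ := 𝒢.exists_compactOpens hO hx
  exact Filter.mem_of_superset ((isOpen_basic M n W).mem_nhds ⟨x, hxW, rfl⟩)
    (Set.image_mono hW)

theorem continuous_proj : Continuous fun a : Tot M => a.1 := by
  refine continuous_def.2 fun O hO => isOpen_iff_mem_nhds.2 fun a ha => ?_
  obtain ⟨n, hn⟩ := exists_pt a
  rw [hn]
  refine Filter.mem_of_superset (pt_mem_nhds M n hO ha) ?_
  rintro _ ⟨y, hy, rfl⟩
  exact hy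

theorem continuous_pt (n : M.carrier) : Continuous (pt M n) := by
  refine continuous_generateFrom_iff.2 ?_
  rintro _ ⟨W, n', rfl⟩
  refine isOpen_iff_mem_nhds.2 fun x hx => ?_
  obtain ⟨y, hy, e⟩ := hx
  obtain rfl : y = x := congrArg Sigma.fst e
  obtain ⟨Z, hZ, h⟩ := (germ_eq_iff M).1 ((pt_eq_pt M).1 e)
  filter_upwards [Z.isOpen.mem_nhds hZ, W.isOpen.mem_nhds hy] with z hz hz'
  exact ⟨z, hz', (pt_eq_pt M).2 ((germ_eq_iff M).2 ⟨Z, hz, h⟩)⟩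

theorem eventually_pt (n : M.carrier) (x : X) : ∀ᶠ a in 𝓝 (pt M n x), a = pt M n a.1 := by
  filter_upwards [pt_mem_nhds M n isOpen_univ (Set.mem_univ x)] with a ha
  obtain ⟨y, -, rfl⟩ := ha
  rfl

theorem continuous_of_eventually {Y : Type*} [TopologicalSpace Y] {f : Y → Tot M}
    (hf : Continuous fun y => (f y).1)
    (h : ∀ y, ∃ n, ∀ᶠ y' in 𝓝 y, f y' = pt M n (f y').1) : Continuous f := by
  refine continuous_iff_continuousAt.2 fun y => ?_
  obtain ⟨n, hn⟩ := h y
  exact ((continuous_pt M n).comp hf).continuousAt.congr (hn.mono fun y' h' => h'.symm)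

theorem isLocalHomeomorph_proj : IsLocalHomeomorph fun a : Tot M => a.1 := by
  refine isLocalHomeomorph_iff_isOpenEmbedding_restrict.2 fun a => ?_
  obtain ⟨n, hn⟩ := exists_pt a
  refine ⟨Set.range (pt M n), ?_, ?_⟩
  · rw [hn, ← Set.image_univ]
    exact pt_mem_nhds M n isOpen_univ (Set.mem_univ _)
  · let h : Set.range (pt M n) ≃ₜ X :=
      { toFun := fun a => a.1.1
        invFun := fun x => ⟨pt M n x, x, rfl⟩
        left_inv := by rintro ⟨_, x, rfl⟩; rfl
        right_inv := fun _ => rfl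
        continuous_toFun := (continuous_proj M).comp continuous_subtype_val
        continuous_invFun := (continuous_pt M n).subtype_mk _ }
    exact h.isOpenEmbedding

/-- The action on the total space, `[m]_{r(g)} g = R_g([m]_{r(g)})`. -/
def totAct (a : Tot M) (g : G) (h : a.1 = 𝒢.r g) : Tot M := ⟨𝒢.d g, R M g (h ▸ a.2)⟩

theorem totAct_pt (n : M.carrier) {x : X} {g : G} (h : x = 𝒢.r g) {U : 𝒢.CompactBisection}
    (hU : g ∈ U.carrier) : totAct M (pt M n x) g h = pt M (M.act n (chi U)) (𝒢.d g) := by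
  subst h
  exact congrArg (Sigma.mk _) (R_germ M hU n)

/-- The underlying `𝒢`-sheaf of `Sh(M)`. -/
def gsheaf : GSheaf.{u, v, max u m} 𝒢 where
  E := Tot M
  p a := a.1
  isLocalHomeomorph_p := isLocalHomeomorph_proj M
  act := totAct M
  continuous_act := by
    refine continuous_of_eventually M
      (𝒢.continuous_d.comp (continuous_snd.comp continuous_subtype_val)) ?_
    rintro ⟨⟨a, g⟩, h⟩
    obtain ⟨n, hn⟩ := exists_pt a
    refine ⟨M.act n (chi (bisectionAt (𝒢 := 𝒢) g)), ?_⟩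
    have h1 := (continuous_fst.comp continuous_subtype_val).tendsto
      (⟨(a, g), h⟩ : {q : Tot M × G // q.1.1 = 𝒢.r q.2})
    have h2 := (continuous_snd.comp continuous_subtype_val).tendsto
      (⟨(a, g), h⟩ : {q : Tot M × G // q.1.1 = 𝒢.r q.2})
    have h3 : ∀ᶠ b in 𝓝 a, b = pt M n b.1 := by
      have := eventually_pt M n a.1
      rwa [← hn] at this
    filter_upwards [h1.eventually h3,
      h2.eventually ((bisectionAt (𝒢 := 𝒢) g).isOpen.mem_nhds (mem_bisectionAt g))]
    rintro ⟨⟨b, k⟩, hbk⟩ hb hk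
    obtain ⟨x, s⟩ := b
    obtain rfl : s = germ M x n := eq_of_heq (Sigma.mk.inj hb).2
    exact totAct_pt M n hbk hk
  act_unit a := by
    obtain ⟨n, hn⟩ := exists_pt a
    obtain ⟨x, s⟩ := a
    obtain rfl : s = germ M x n := eq_of_heq (Sigma.mk.inj hn).2
    obtain ⟨W, hW, -⟩ := 𝒢.exists_compactOpens isOpen_univ (Set.mem_univ x)
    refine (totAct_pt M n (g := 𝒢.unit x) (𝒢.r_unit x).symm
      (U := CompactBisection.ofUnits W) ⟨x, hW, rfl⟩).trans ?_
    rw [𝒢.d_unit]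
    exact (pt_eq_pt M).2 (germ_act_chiUnits M hW n)
  p_act _ _ _ := rfl
  act_act a g g' h h' := by
    obtain ⟨n, hn⟩ := exists_pt a
    obtain ⟨x, s⟩ := a
    obtain rfl : s = germ M x n := eq_of_heq (Sigma.mk.inj hn).2
    have h1 := totAct_pt M n h (mem_bisectionAt g)
    have h2 := totAct_pt M (M.act n (chi (bisectionAt g))) h' (mem_bisectionAt g')
    have h3 := totAct_pt M n (h.trans (𝒢.r_mul g g' h').symm)
      (U := (bisectionAt g).mul (bisectionAt g'))
      ⟨g, mem_bisectionAt g, g', mem_bisectionAt g', h', rfl⟩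
    rw [← M.act_mul, chi_mul_chi, ← 𝒢.d_mul g g' h'] at h2
    refine Eq.trans ?_ (h2.trans h3.symm)
    congr 1

/-- The fibre of the total space over `x` is `M_x`. -/
def fiberEquiv (x : X) : (gsheaf M).Stalk x ≃ Stalk M x where
  toFun a := a.2 ▸ a.1.2
  invFun s := ⟨⟨x, s⟩, rfl⟩
  left_inv := by rintro ⟨⟨y, s⟩, rfl⟩; rfl
  right_inv _ := rfl

instance (x : X) : AddCommGroup ((gsheaf M).Stalk x) := (fiberEquiv M x).addCommGroup

instance (x : X) : Module 𝕜 ((gsheaf M).Stalk x) := (fiberEquiv M x).module 𝕜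

/-- The point `[n]_x` of the fibre over `x`. -/
def fpt (n : M.carrier) (x : X) : (gsheaf M).Stalk x := ⟨pt M n x, rfl⟩

theorem fpt_add (n n' : M.carrier) (x : X) : fpt M n x + fpt M n' x = fpt M (n + n') x :=
  congrArg (fiberEquiv M x).symm (map_add (germ M x) n n').symm

theorem fpt_smul (c : 𝕜) (n : M.carrier) (x : X) : c • fpt M n x = fpt M (c • n) x :=
  congrArg (fiberEquiv M x).symm (map_smul (germ M x) c n).symm

theorem fpt_zero (x : X) : fpt M 0 x = 0 :=
  congrArg (fiberEquiv M x).symm (map_zero (germ M x))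

theorem exists_fpt {x : X} (a : (gsheaf M).Stalk x) : ∃ n, a = fpt M n x := by
  obtain ⟨a, rfl⟩ := a
  obtain ⟨n, hn⟩ := exists_pt a
  exact ⟨n, Subtype.ext hn⟩

theorem R_fpt {g : G} {U : 𝒢.CompactBisection} (hU : g ∈ U.carrier) (n : M.carrier) :
    (gsheaf M).R g (fpt M n (𝒢.r g)) = fpt M (M.act n (chi U)) (𝒢.d g) :=
  Subtype.ext (totAct_pt M n rfl hU)

/-- The `𝒢`-sheaf of `𝕜`-modules `Sh(M)`. -/
def shObj : ModuleSheaf.{u, v, w, max u m} 𝒢 𝕜 where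
  toGSheaf := gsheaf M
  continuous_zero := by
    have h : (fun x => (0 : (gsheaf M).Stalk x).1) = pt M 0 :=
      funext fun x => congrArg Subtype.val (fpt_zero M x).symm
    rw [h]
    exact continuous_pt M 0
  continuous_add := by
    have hc := (continuous_snd.comp
      (continuous_subtype_val (p := fun q : Tot M × Tot M => q.1.1 = q.2.1)))
    have hc' := (continuous_fst.comp
      (continuous_subtype_val (p := fun q : Tot M × Tot M => q.1.1 = q.2.1)))
    refine continuous_of_eventually M (f := fun q : {q : Tot M × Tot M // q.1.1 = q.2.1} =>
      ((gsheaf M).toStalk (x := (gsheaf M).p q.1.2) q.1.1 q.2 +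
        (gsheaf M).toStalk q.1.2 rfl).1) ?_ ?_
    · exact ((continuous_proj M).comp hc :)
    · rintro ⟨⟨a, b⟩, h⟩
      obtain ⟨n, hn⟩ := exists_pt a
      obtain ⟨n', hn'⟩ := exists_pt b
      have h1 := eventually_pt M n a.1
      have h2 := eventually_pt M n' b.1
      rw [← hn] at h1
      rw [← hn'] at h2
      refine ⟨n + n', ?_⟩
      filter_upwards [(hc'.tendsto ⟨⟨a, b⟩, h⟩).eventually h1,
        (hc.tendsto ⟨⟨a, b⟩, h⟩).eventually h2]
      rintro ⟨⟨⟨x, s⟩, ⟨y, t⟩⟩, e⟩ hs ht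
      change x = y at e
      subst e
      obtain rfl : s = germ M x n := eq_of_heq (Sigma.mk.inj hs).2
      obtain rfl : t = germ M x n' := eq_of_heq (Sigma.mk.inj ht).2
      exact congrArg Subtype.val (fpt_add M n n' x)
  continuous_smul c := by
    refine continuous_of_eventually M (f := fun a : Tot M =>
      (c • (gsheaf M).toStalk a rfl).1) ?_ ?_
    · exact continuous_proj M
    · intro a
      obtain ⟨n, hn⟩ := exists_pt a
      have h1 := eventually_pt M n a.1
      rw [← hn] at h1
      refine ⟨c • n, ?_⟩
      filter_upwards [h1]
      rintro ⟨x, s⟩ hs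
      obtain rfl : s = germ M x n := eq_of_heq (Sigma.mk.inj hs).2
      exact congrArg Subtype.val (fpt_smul M c n x)
  R_add g a b := by
    obtain ⟨n, rfl⟩ := exists_fpt M a
    obtain ⟨n', rfl⟩ := exists_fpt M b
    rw [fpt_add, R_fpt M (mem_bisectionAt g), R_fpt M (mem_bisectionAt g),
      R_fpt M (mem_bisectionAt g), fpt_add, map_add, AddMonoidHom.add_apply]
  R_smul g c a := by
    obtain ⟨n, rfl⟩ := exists_fpt M a
    rw [fpt_smul, R_fpt M (mem_bisectionAt g), R_fpt M (mem_bisectionAt g), fpt_smul, smul_act]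

section Map

variable {M} {N : UnitaryRightModule.{max v w, m} (GroupoidAlgebra 𝒢 𝕜)}
  (f : UnitaryRightModule.Hom M N)

/-- Homomorphisms of unitary `𝕜𝒢`-modules are `𝕜`-linear. -/
def homLin : M.carrier →ₗ[𝕜] N.carrier where
  toFun := f.toAddMonoidHom
  map_add' := map_add f.toAddMonoidHom
  map_smul' c n := by
    obtain ⟨W, hW⟩ := exists_act_chiUnits M n
    rw [smul_eq M c hW, f.map_act, act_smul, ← f.map_act, hW]
    rfl

/-- The map `f_x : M_x → N_x` induced by `f` on the direct limits. -/
def stalkMap (x : X) : Stalk M x →ₗ[𝕜] Stalk N x :=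
  Module.DirectLimit.map (fun W => (homLin f).restrict (p := part M W.set) (q := part N W.set)
    (by rintro _ ⟨n, rfl⟩; exact ⟨homLin f n, (f.map_act n _).symm⟩))
    (fun V W _ => LinearMap.ext fun n => Subtype.ext (f.map_act n.1 _))

theorem stalkMap_germ (x : X) (n : M.carrier) :
    stalkMap f x (germ M x n) = germ N x (f.toAddMonoidHom n) := by
  refine (Module.DirectLimit.map_apply_of _ _ _).trans ?_
  exact congrArg (Stalk.of N _) (Subtype.ext (f.map_act n _))

/-- The map of total spaces `[n]_x ↦ [f(n)]_x`. -/
def totMap (a : Tot M) : Tot N := ⟨a.1, stalkMap f a.1 a.2⟩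

theorem totMap_pt (n : M.carrier) (x : X) :
    totMap f (pt M n x) = pt N (f.toAddMonoidHom n) x :=
  congrArg (Sigma.mk x) (stalkMap_germ f x n)

/-- The underlying morphism of `𝒢`-sheaves of `Sh(f)`. -/
def gsheafMap : GSheaf.Hom (gsheaf M) (gsheaf N) where
  toFun := totMap f
  continuous_toFun := by
    refine continuous_of_eventually N (continuous_proj M) fun a => ?_
    obtain ⟨n, hn⟩ := exists_pt a
    have h1 := eventually_pt M n a.1
    rw [← hn] at h1
    refine ⟨f.toAddMonoidHom n, ?_⟩
    filter_upwards [h1] with b hb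
    rw [hb]
    exact totMap_pt f n b.1
  p_toFun _ := rfl
  map_act a g h := by
    obtain ⟨n, hn⟩ := exists_pt a
    obtain ⟨x, s⟩ := a
    obtain rfl : s = germ M x n := eq_of_heq (Sigma.mk.inj hn).2
    refine (congrArg (totMap f) (totAct_pt M n h (mem_bisectionAt g))).trans ?_
    rw [totMap_pt, f.map_act, ← totAct_pt N (f.toAddMonoidHom n) h (mem_bisectionAt g)]
    change _ = totAct N (totMap f (pt M n x)) g _
    congr 1
    exact (totMap_pt f n x).symm

theorem stalkMap_fpt (n : M.carrier) (x : X) :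
    (gsheafMap f).stalkMap x (fpt M n x) = fpt N (f.toAddMonoidHom n) x :=
  Subtype.ext (totMap_pt f n x)

/-- The morphism `Sh(f)`. -/
def shMap : ModuleSheaf.Hom (shObj M) (shObj N) where
  toHom := gsheafMap f
  map_add x a b := by
    obtain ⟨n, rfl⟩ := exists_fpt M a
    obtain ⟨n', rfl⟩ := exists_fpt M b
    change (gsheafMap f).stalkMap x (fpt M n x + fpt M n' x) =
      (gsheafMap f).stalkMap x (fpt M n x) + (gsheafMap f).stalkMap x (fpt M n' x)
    rw [fpt_add, stalkMap_fpt, stalkMap_fpt, stalkMap_fpt, fpt_add, map_add]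
  map_smul x c a := by
    obtain ⟨n, rfl⟩ := exists_fpt M a
    change (gsheafMap f).stalkMap x (c • fpt M n x) = c • (gsheafMap f).stalkMap x (fpt M n x)
    rw [fpt_smul, stalkMap_fpt, stalkMap_fpt, fpt_smul]
    exact congrArg (fpt N · x) ((homLin f).map_smul c n)

end Map

end Sh

/-- The functor `Sh` from unitary right `𝕜𝒢`-modules to `𝒢`-sheaves of `𝕜`-modules. -/
def shFunctor (𝒢 : TopologicalGroupoid X G) [𝒢.IsAmple] (𝕜 : Type w) [CommRing 𝕜] :
    UnitaryRightModule.{max v w, m} (GroupoidAlgebra 𝒢 𝕜) ⥤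
      ModuleSheaf.{u, v, w, max u m} 𝒢 𝕜 where
  obj M := Sh.shObj M
  map f := Sh.shMap f
  map_id M := by
    refine ModuleSheaf.Hom.ext (funext fun a => ?_)
    obtain ⟨n, hn⟩ := Sh.exists_pt (M := M) a
    rw [hn]
    exact Sh.totMap_pt (𝟙 M) n _
  map_comp {M N P} f h := by
    refine ModuleSheaf.Hom.ext (funext fun a => ?_)
    obtain ⟨n, hn⟩ := Sh.exists_pt (M := M) a
    rw [hn]
    refine (Sh.totMap_pt (f ≫ h) n _).trans ?_
    refine Eq.trans ?_ (congrArg (Sh.totMap h) (Sh.totMap_pt f n a.1)).symm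
    exact (Sh.totMap_pt h _ _).symm

end

end TopologicalGroupoid

/-!
A unitary module `M` over `𝕜𝒢` is recovered from its germs, and a sheaf from its compactly supported
sections.

The map `M → Γ_c(Sh(M))` sends `n` to the section `x ↦ [n]_x`. If `nχ_W = n`, this section vanishes
off the compact open set `W`, which is closed as `X` is Hausdorff. Both halves of bijectivity come
from compactness and the fact that compact open sets are closed under differences, so that finite
covers by them can be made disjoint: if all germs of `n` vanish, then `nχ_V = 0` for some compact
open `V ⊇ W`, whence `n = nχ_V = 0` (`Sh.eq_zero_of_germ_eq_zero`), and local representatives of a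
section can be glued to a single element of `M` over a neighbourhood of its support
(`Sh.exists_fpt_eq_on`).

The map `Sh(Γ_c(E)) → E` sends `[s]_x` to `s(x)`. As `p` is a local homeomorphism, two continuous
sections that agree at `x` agree near `x`, so germs are the same as values
(`ModuleSheaf.germ_eq_germ_iff`), and a local section over a compact open set extends by zero, so
that every point is a value (`ModuleSheaf.exists_value_eq`). A bijective morphism of sheaves is
invertible because it is a local homeomorphism.
-/

namespace TopologicalGroupoid

variable {X : Type u} {G : Type v} [TopologicalSpace X] [TopologicalSpace G]

noncomputable section

/-! ### Compact open sets of units -/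

theorem exists_compactOpens_sdiff (𝒢 : TopologicalGroupoid X G) [𝒢.IsAmple]
    (V W : TopologicalSpace.CompactOpens X) :
    ∃ Z : TopologicalSpace.CompactOpens X, (Z : Set X) = (V : Set X) \ W := by
  have := IsAmple.t2Space (𝒢 := 𝒢)
  exact ⟨⟨⟨V \ W, V.isCompact.diff W.isOpen⟩, V.isOpen.sdiff W.isCompact.isClosed⟩, rfl⟩

/-- Additivity of characteristic functions on the disjoint decomposition `V ∪ W = V ⊔ (W \ V)`. -/
theorem GroupoidAlgebra.chiUnits_sup {𝒢 : TopologicalGroupoid X G} [𝒢.IsAmple] {𝕜 : Type w}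
    [CommRing 𝕜] (V W Z : TopologicalSpace.CompactOpens X) (h : (Z : Set X) = (W : Set X) \ V) :
    (chiUnits (V ⊔ W) : GroupoidAlgebra 𝒢 𝕜) = chiUnits V + chiUnits Z := by
  have hinj : Function.Injective 𝒢.unit := fun x y e => by
    rw [← 𝒢.d_unit x, e, 𝒢.d_unit]
  refine Subtype.ext ?_
  change charFun 𝕜 (𝒢.unit '' ((V : Set X) ∪ W)) =
    charFun 𝕜 (𝒢.unit '' (V : Set X)) + charFun 𝕜 (𝒢.unit '' (Z : Set X))
  rw [h, ← Set.union_sdiff_self, Set.image_union]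
  exact Set.indicator_union_of_disjoint
    ((Set.disjoint_image_iff hinj).2 Set.disjoint_sdiff_right) _

/-! ### Modules as modules of sections -/

namespace Sh

open GroupoidAlgebra

variable {𝒢 : TopologicalGroupoid X G} [𝒢.IsAmple] {𝕜 : Type w} [CommRing 𝕜]
  (M : UnitaryRightModule.{max v w, m} (GroupoidAlgebra 𝒢 𝕜))

theorem germ_act_chi_of_notMem {x : X} (U : 𝒢.CompactBisection) (hx : x ∉ 𝒢.d '' U.carrier)
    (n : M.carrier) : germ M x (M.act n (chi U)) = 0 := by
  have := IsAmple.t2Space (𝒢 := 𝒢)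
  obtain ⟨W, hxW, hW⟩ := 𝒢.exists_compactOpens U.dom.isCompact.isClosed.isOpen_compl hx
  rw [← germ_act_chiUnits M hxW, ← M.act_mul, chiUnits, chi_mul_chi]
  have h0 : (chi (U.mul (CompactBisection.ofUnits W)) : GroupoidAlgebra 𝒢 𝕜) = 0 := by
    refine Subtype.ext (funext fun g => charFun_of_notMem ?_)
    rw [U.carrier_mul_ofUnits]
    exact fun hg => hW hg.2 ⟨g, hg.1, rfl⟩
  rw [h0, map_zero, map_zero]

theorem germ_act_chiUnits_of_notMem {x : X} {W : TopologicalSpace.CompactOpens X} (hx : x ∉ W)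
    (n : M.carrier) : germ M x (M.act n (chiUnits W)) = 0 := by
  refine germ_act_chi_of_notMem M _ ?_ n
  rintro ⟨_, ⟨y, hy, rfl⟩, e⟩
  rw [𝒢.d_unit] at e
  exact hx (e ▸ hy)

/-- An element of a unitary module is determined by its germs. The compact open sets `V` with
`nχ_V = 0` are closed under finite unions and cover `X`, so that one of them contains a set `W` with
`nχ_W = n`. -/
theorem eq_zero_of_germ_eq_zero {n : M.carrier} (h : ∀ x, germ M x n = 0) : n = 0 := by
  obtain ⟨W, hW⟩ := exists_act_chiUnits M n
  have key : ∃ V : TopologicalSpace.CompactOpens X, (W : Set X) ⊆ V ∧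
      M.act n (chiUnits V) = 0 := by
    refine W.isCompact.induction_on
      (p := fun K => ∃ V : TopologicalSpace.CompactOpens X, K ⊆ V ∧ M.act n (chiUnits V) = 0)
      ?_ ?_ ?_ ?_
    -- `χ_∅ = 0` follows from `χ_W = χ_W + χ_∅`.
    · obtain ⟨Z, hZ⟩ := 𝒢.exists_compactOpens_sdiff W W
      refine ⟨Z, Set.empty_subset _, ?_⟩
      have h0 : (chiUnits Z : GroupoidAlgebra 𝒢 𝕜) = 0 := by
        have := chiUnits_sup (𝒢 := 𝒢) (𝕜 := 𝕜) W W Z hZ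
        rwa [sup_idem, left_eq_add] at this
      rw [h0, map_zero]
    · rintro s t hst ⟨V, hV, hn⟩
      exact ⟨V, hst.trans hV, hn⟩
    · rintro s t ⟨V, hV, hn⟩ ⟨V', hV', hn'⟩
      obtain ⟨Z, hZ⟩ := 𝒢.exists_compactOpens_sdiff V' V
      refine ⟨V ⊔ V', Set.union_subset_union hV hV', ?_⟩
      have hle : Z ≤ V' := show (Z : Set X) ⊆ V' by rw [hZ]; exact Set.sdiff_subset
      rw [chiUnits_sup V V' Z hZ, map_add, hn, ← chiUnits_mul_of_ge hle, M.act_mul, hn']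
      simp
    · intro x _
      obtain ⟨V, hx, hV⟩ := germ_eq_zero M (h x)
      exact ⟨V, mem_nhdsWithin_of_mem_nhds (V.isOpen.mem_nhds hx), V, subset_rfl, hV⟩
  obtain ⟨V, hWV, hV⟩ := key
  rw [← act_of_le M hWV hW, hV]

theorem fpt_act_chi_of_notMem {x : X} (U : 𝒢.CompactBisection) (hx : x ∉ 𝒢.d '' U.carrier)
    (n : M.carrier) : fpt M (M.act n (chi U)) x = 0 := by
  rw [← fpt_zero]
  exact Subtype.ext ((pt_eq_pt M).2 ((germ_act_chi_of_notMem M U hx n).trans (map_zero _).symm))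

/-- The section `x ↦ [n]_x` of `Sh(M)` has compact support. -/
theorem fpt_mem_sections (n : M.carrier) : (fun x => fpt M n x) ∈ (shObj M).sections := by
  obtain ⟨W, hW⟩ := exists_act_chiUnits M n
  refine ⟨continuous_pt M n, W.isCompact.of_isClosed_subset
    ((shObj M).isClosed_support (continuous_pt M n)) fun x hx => ?_⟩
  by_contra hn
  refine hx (Subtype.ext ?_)
  change pt M n x = (0 : (gsheaf M).Stalk x).1
  rw [← fpt_zero]
  refine (pt_eq_pt M).2 ?_
  rw [← hW, germ_act_chiUnits_of_notMem M hn, map_zero]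

theorem fpt_act (n : M.carrier) (a : GroupoidAlgebra 𝒢 𝕜) :
    (fun x => fpt M (M.act n a) x) = (shObj M).sectionAct (fun x => fpt M n x) a.1 := by
  induction a using GroupoidAlgebra.induction with
  | chi U =>
    funext x
    by_cases hx : x ∈ 𝒢.d '' U.carrier
    · obtain ⟨g, hg, rfl⟩ := hx
      refine Eq.trans ?_ ((shObj M).sectionAct_charFun_of_mem _ U ⟨g, rfl⟩ hg).symm
      exact (R_fpt M hg n).symm
    · exact (fpt_act_chi_of_notMem M U hx n).trans
        ((shObj M).sectionAct_charFun_of_notMem _ U hx).symm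
  | zero =>
    refine Eq.trans ?_ ((shObj M).sectionAct_zero_right _).symm
    rw [map_zero]
    exact funext fun x => fpt_zero M x
  | add a b ha hb =>
    refine Eq.trans ?_ ((shObj M).sectionAct_add_right _ a.2 b.2).symm
    rw [← ha, ← hb, map_add]
    exact funext fun x => (fpt_add M _ _ x).symm
  | smul c a ha =>
    refine Eq.trans ?_ ((shObj M).sectionAct_smul_right c _ a.2).symm
    rw [← ha, act_smul]
    exact funext fun x => (fpt_smul M c _ x).symm

/-- The unit of the equivalence, `n ↦ (x ↦ [n]_x)`. -/
def toSections (M : UnitaryRightModule.{max v w, max u t} (GroupoidAlgebra 𝒢 𝕜)) :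
    UnitaryRightModule.Hom M (shObj M).gammaObj where
  toAddMonoidHom := AddMonoidHom.mk' (fun n => (⟨fun x => fpt M n x, fpt_mem_sections M n⟩ :
      (shObj M).sections))
    fun n n' => Subtype.ext (funext fun x => (fpt_add M n n' x).symm)
  map_act n a := Subtype.ext (fpt_act M n a)

theorem toSections_injective
    (M : UnitaryRightModule.{max v w, max u t} (GroupoidAlgebra 𝒢 𝕜)) :
    Function.Injective (toSections.{u, v, w, t} M).toAddMonoidHom := by
  refine (injective_iff_map_eq_zero _).2 fun n hn => eq_zero_of_germ_eq_zero M fun x => ?_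
  have h1 : fpt M n x = fpt M 0 x :=
    (congrFun (congrArg Subtype.val hn) x).trans (fpt_zero M x).symm
  exact ((pt_eq_pt M).1 (congrArg Subtype.val h1)).trans (map_zero _)

/-- A section of `Sh(M)` is given by a single element of `M` near any compact set: representatives
over `V` and `V'` are glued along the disjoint cover of `V ∪ V'` by `V` and `V' \ V`. -/
theorem exists_fpt_eq_on {s : ∀ x, (shObj M).Stalk x} (hs : Continuous fun x => (s x).1)
    {K : Set X} (hK : IsCompact K) : ∃ (V : TopologicalSpace.CompactOpens X) (n : M.carrier),
      K ⊆ V ∧ ∀ x ∈ V, s x = fpt M n x := by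
  refine hK.induction_on ⟨⊥, 0, Set.empty_subset _, fun x hx => hx.elim⟩ ?_ ?_ ?_
  · rintro s t hst ⟨V, n, hV, hn⟩
    exact ⟨V, n, hst.trans hV, hn⟩
  · rintro K K' ⟨V, n, hV, hn⟩ ⟨V', n', hV', hn'⟩
    obtain ⟨Z, hZ⟩ := 𝒢.exists_compactOpens_sdiff V' V
    have hmem : ∀ x, x ∈ Z ↔ x ∈ V' ∧ x ∉ V := fun x => by
      rw [← SetLike.mem_coe, hZ]; rfl
    refine ⟨V ⊔ V', M.act n (chiUnits V) + M.act n' (chiUnits Z),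
      Set.union_subset_union hV hV', fun x hx => ?_⟩
    by_cases hxV : x ∈ V
    · rw [hn x hxV]
      refine Subtype.ext ((pt_eq_pt M).2 ?_)
      rw [map_add, germ_act_chiUnits M hxV,
        germ_act_chiUnits_of_notMem M fun h => ((hmem x).1 h).2 hxV, add_zero]
    · have hxV' : x ∈ V' := hx.resolve_left hxV
      rw [hn' x hxV']
      refine Subtype.ext ((pt_eq_pt M).2 ?_)
      rw [map_add, germ_act_chiUnits_of_notMem M hxV,
        germ_act_chiUnits M ((hmem x).2 ⟨hxV', hxV⟩), zero_add]
  · intro x _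
    obtain ⟨n, hn⟩ := exists_fpt M (s x)
    obtain ⟨V, hxV, hV⟩ := 𝒢.exists_compactOpens
      ((shObj M).isOpen_setOf_eq (t := fun y => fpt M n y) hs (continuous_pt M n)) hn
    exact ⟨V, mem_nhdsWithin_of_mem_nhds (V.isOpen.mem_nhds hxV), V, n, subset_rfl,
      fun y hy => hV hy⟩

theorem toSections_surjective
    (M : UnitaryRightModule.{max v w, max u t} (GroupoidAlgebra 𝒢 𝕜)) :
    Function.Surjective (toSections.{u, v, w, t} M).toAddMonoidHom := by
  intro s
  obtain ⟨V, n, hV, hn⟩ := exists_fpt_eq_on M s.2.1 s.2.2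
  refine ⟨M.act n (chiUnits V), Subtype.ext (funext fun x => ?_)⟩
  change fpt M (M.act n (chiUnits V)) x = s.1 x
  by_cases hx : x ∈ V
  · rw [hn x hx]
    exact Subtype.ext ((pt_eq_pt M).2 (germ_act_chiUnits M hx n))
  · have h0 : s.1 x = 0 := by_contra fun h => hx (hV h)
    refine Eq.trans ?_ ((fpt_zero M x).trans h0.symm)
    exact Subtype.ext ((pt_eq_pt M).2
      ((germ_act_chiUnits_of_notMem M hx n).trans (map_zero _).symm))

end Sh

end

end TopologicalGroupoid

namespace UnitaryRightModule

universe a b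

/-- A bijective homomorphism of unitary modules is an isomorphism. -/
noncomputable def isoOfBijective {R : Type a} [NonUnitalRing R] {M N : UnitaryRightModule.{a, b} R}
    (f : M ⟶ N) (hf : Function.Bijective (Hom.toAddMonoidHom f)) : M ≅ N where
  hom := f
  inv :=
    { toAddMonoidHom := (AddEquiv.ofBijective (Hom.toAddMonoidHom f) hf).symm.toAddMonoidHom
      map_act := fun n r => hf.1 (by
        have h := (AddEquiv.ofBijective (Hom.toAddMonoidHom f) hf).apply_symm_apply
        exact (h _).trans ((Hom.map_act f _ r).trans
          (congrArg (fun k => N.act k r) (h n))).symm) }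
  hom_inv_id := Hom.ext (AddMonoidHom.ext fun n =>
    (AddEquiv.ofBijective (Hom.toAddMonoidHom f) hf).symm_apply_apply n)
  inv_hom_id := Hom.ext (AddMonoidHom.ext fun n =>
    (AddEquiv.ofBijective (Hom.toAddMonoidHom f) hf).apply_symm_apply n)

end UnitaryRightModule

namespace TopologicalGroupoid

variable {X : Type u} {G : Type v} [TopologicalSpace X] [TopologicalSpace G]

noncomputable section

/-! ### Sheaves as sheaves of germs of sections -/

namespace ModuleSheaf

open GroupoidAlgebra

/-- A bijective morphism of `𝒢`-sheaves of `𝕜`-modules is an isomorphism: maps of spaces étale over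
the same base are local homeomorphisms, hence open, so that the inverse is continuous. -/
def isoOfBijective {𝒢 : TopologicalGroupoid X G} {𝕜 : Type w} [CommRing 𝕜]
    {ℰ ℱ : ModuleSheaf.{u, v, w, e} 𝒢 𝕜} (φ : ℰ ⟶ ℱ)
    (hφ : Function.Bijective φ.toFun) : ℰ ≅ ℱ := by
  let E := Equiv.ofBijective φ.toFun hφ
  have hE : ∀ a, φ.toFun (E.symm a) = a := E.apply_symm_apply
  have hp : ∀ a, ℰ.p (E.symm a) = ℱ.p a := fun a => by
    rw [← φ.p_toFun, hE]
  have hinj : ∀ x, Function.Injective (φ.stalkMap x) := fun x a b h =>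
    Subtype.ext (hφ.1 (congrArg Subtype.val h))
  have hlocal : IsLocalHomeomorph φ.toFun := by
    refine IsLocalHomeomorph.of_comp (g := ℱ.p) ?_ ℱ.isLocalHomeomorph_p φ.continuous_toFun
    rw [show ℱ.p ∘ φ.toFun = ℰ.p from funext φ.p_toFun]
    exact ℰ.isLocalHomeomorph_p
  let ψ : GSheaf.Hom ℱ.toGSheaf ℰ.toGSheaf :=
    { toFun := E.symm
      continuous_toFun := (E.toHomeomorphOfContinuousOpen φ.continuous_toFun
        hlocal.isOpenMap).continuous_symm
      p_toFun := hp
      map_act := fun a g h => hφ.1 (by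
        rw [hE, φ.map_act _ g ((hp a).trans h)]
        congr 1
        exact (hE a).symm) }
  have hψ : ∀ x a, φ.stalkMap x (ψ.stalkMap x a) = a := fun x a => Subtype.ext (hE a.1)
  exact
    { hom := φ
      inv :=
        { toHom := ψ
          map_add := fun x a b => hinj x (by
            rw [hψ, φ.map_add, hψ, hψ])
          map_smul := fun x c a => hinj x (by
            rw [hψ, φ.map_smul, hψ]) }
      hom_inv_id := Hom.ext (funext E.symm_apply_apply)
      inv_hom_id := Hom.ext (funext E.apply_symm_apply) }

variable {𝒢 : TopologicalGroupoid X G} [𝒢.IsAmple] {𝕜 : Type w} [CommRing 𝕜]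
  (ℰ : ModuleSheaf.{u, v, w, max u t} 𝒢 𝕜)

theorem sectionAct_chiUnits_of_mem (s : ∀ x, ℰ.Stalk x) {W : TopologicalSpace.CompactOpens X}
    {x : X} (hx : x ∈ W) :
    ℰ.sectionAct s (chiUnits (𝒢 := 𝒢) (𝕜 := 𝕜) W).1 x = s x := by
  have h1 := ℰ.sectionAct_charFun_of_mem s (CompactBisection.ofUnits W)
    ⟨𝒢.unit x, 𝒢.d_unit x⟩ ⟨x, hx, rfl⟩
  refine h1.trans ?_
  classical
  -- The value at `x` is unchanged if `s` is replaced by the section that vanishes off `W`.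
  have h2 := congrFun (ℰ.sectionAct_chiUnits (s := fun y => if y ∈ W then s y else 0) W
    fun y hy => by by_contra hn; exact hy (if_neg hn)) x
  have h3 := ℰ.sectionAct_charFun_of_mem (fun y => if y ∈ W then s y else 0)
    (CompactBisection.ofUnits W) ⟨𝒢.unit x, 𝒢.d_unit x⟩ ⟨x, hx, rfl⟩
  have h4 := h3.symm.trans h2
  dsimp only at h4
  rwa [if_pos hx, if_pos (by rw [𝒢.r_unit]; exact hx)] at h4

theorem sectionAct_chiUnits_of_notMem (s : ∀ x, ℰ.Stalk x)
    {W : TopologicalSpace.CompactOpens X} {x : X} (hx : x ∉ W) :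
    ℰ.sectionAct s (chiUnits (𝒢 := 𝒢) (𝕜 := 𝕜) W).1 x = 0 := by
  refine ℰ.sectionAct_charFun_of_notMem s (CompactBisection.ofUnits W) ?_
  rintro ⟨_, ⟨y, hy, rfl⟩, e⟩
  rw [𝒢.d_unit] at e
  exact hx (e ▸ hy)

/-- The value of a compactly supported section. -/
def value (s : ℰ.gammaObj.carrier) (x : X) : ℰ.Stalk x := s.1 x

theorem value_ext {s t : ℰ.gammaObj.carrier} (h : ∀ x, ℰ.value s x = ℰ.value t x) : s = t :=
  Subtype.ext (funext h)

theorem continuous_value (s : ℰ.gammaObj.carrier) : Continuous fun x => (ℰ.value s x).1 := s.2.1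

/-- The scalar multiplication that `Γ_c(E)` carries as a unitary `𝕜𝒢`-module is the pointwise
one. -/
theorem value_smul (c : 𝕜) (s : ℰ.gammaObj.carrier) (x : X) :
    ℰ.value (c • s) x = c • ℰ.value s x := by
  obtain ⟨W, hW⟩ := Sh.exists_act_chiUnits ℰ.gammaObj s
  rw [Sh.smul_eq _ c hW]
  refine (congrFun (ℰ.sectionAct_smul_right c s.1 (chiUnits W).2) x).trans ?_
  exact congrArg (c • ·) (congrFun (congrArg Subtype.val hW) x)

/-- Two compactly supported sections have the same germ at `x` if and only if they agree at `x`. -/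
theorem germ_eq_germ_iff {s t : ℰ.gammaObj.carrier} {x : X} :
    Sh.germ ℰ.gammaObj x s = Sh.germ ℰ.gammaObj x t ↔ ℰ.value s x = ℰ.value t x := by
  rw [Sh.germ_eq_iff]
  constructor
  · rintro ⟨W, hx, h⟩
    have h1 := congrFun (congrArg Subtype.val h) x
    exact (ℰ.sectionAct_chiUnits_of_mem s.1 hx).symm.trans
      (h1.trans (ℰ.sectionAct_chiUnits_of_mem t.1 hx))
  · intro h
    obtain ⟨W, hx, hW⟩ := 𝒢.exists_compactOpens
      (ℰ.isOpen_setOf_eq (ℰ.continuous_value s) (ℰ.continuous_value t)) h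
    refine ⟨W, hx, ℰ.value_ext fun y => ?_⟩
    change ℰ.sectionAct s.1 _ y = ℰ.sectionAct t.1 _ y
    by_cases hy : y ∈ W
    · rw [ℰ.sectionAct_chiUnits_of_mem _ hy, ℰ.sectionAct_chiUnits_of_mem _ hy]
      exact hW hy
    · rw [ℰ.sectionAct_chiUnits_of_notMem _ hy, ℰ.sectionAct_chiUnits_of_notMem _ hy]

/-- Every point of a `𝒢`-sheaf lies on a compactly supported section: a local section over a
compact open set, extended by zero. -/
theorem exists_value_eq {x : X} (a : ℰ.Stalk x) : ∃ s : ℰ.gammaObj.carrier, ℰ.value s x = a := by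
  have := IsAmple.t2Space (𝒢 := 𝒢)
  obtain ⟨a, rfl⟩ := a
  obtain ⟨e, he, hep⟩ := ℰ.isLocalHomeomorph_p a
  have hx : ℰ.p a ∈ e.target := by rw [hep]; exact e.map_source he
  obtain ⟨W, hxW, hW⟩ := 𝒢.exists_compactOpens e.open_target hx
  have hsec : ∀ y ∈ W, ℰ.p (e.symm y) = y := fun y hy => by
    rw [hep]; exact e.right_inv (hW hy)
  classical
  let s : ∀ y, ℰ.Stalk y := fun y => if h : y ∈ W then ⟨e.symm y, hsec y h⟩ else 0
  have hs : Continuous fun y => (s y).1 := by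
    rw [← continuousOn_univ, ← Set.union_compl_self (W : Set X)]
    refine ContinuousOn.union_of_isOpen ?_ ?_ W.isOpen W.isCompact.isClosed.isOpen_compl
    · refine (e.continuousOn_symm.mono hW).congr fun y hy => ?_
      exact congrArg Subtype.val (dif_pos hy)
    · refine ℰ.continuous_zero.continuousOn.congr fun y hy => ?_
      exact congrArg Subtype.val (dif_neg hy)
  refine ⟨⟨s, hs, W.isCompact.of_isClosed_subset (ℰ.isClosed_support hs) fun y hy => ?_⟩, ?_⟩
  · by_contra hn
    exact hy (dif_neg hn)
  · refine (dif_pos hxW).trans (Subtype.ext ?_)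
    change e.symm (ℰ.p a) = a
    rw [hep, e.left_inv he]

/-- The map `[s]_x ↦ s(x)` of total spaces, defined by choosing a representative `s` of the germ; it
does not depend on the choice by `evalFun_pt`. -/
def evalFun (a : Sh.Tot ℰ.gammaObj) : ℰ.E := (ℰ.value (Sh.exists_pt a).choose a.1).1

theorem evalFun_pt (s : ℰ.gammaObj.carrier) (x : X) :
    ℰ.evalFun (Sh.pt ℰ.gammaObj s x) = (ℰ.value s x).1 := by
  have h := (Sh.exists_pt (Sh.pt ℰ.gammaObj s x)).choose_spec
  exact congrArg Subtype.val (ℰ.germ_eq_germ_iff.1 ((Sh.pt_eq_pt _).1 h)).symm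

/-- The underlying morphism of `𝒢`-sheaves of the counit of the equivalence, `[s]_x ↦ s(x)`. -/
def evalGSheafHom : GSheaf.Hom (Sh.gsheaf ℰ.gammaObj) ℰ.toGSheaf where
  toFun := ℰ.evalFun
  continuous_toFun := by
    refine continuous_iff_continuousAt.2 fun a => ?_
    obtain ⟨s, hs⟩ := Sh.exists_pt (M := ℰ.gammaObj) a
    have h1 := Sh.eventually_pt ℰ.gammaObj s a.1
    rw [← hs] at h1
    refine ((ℰ.continuous_value s).comp
      (Sh.continuous_proj ℰ.gammaObj)).continuousAt.congr (h1.mono fun b hb => ?_)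
    exact (ℰ.evalFun_pt s b.1).symm.trans (congrArg ℰ.evalFun hb.symm)
  p_toFun a := (ℰ.value _ a.1).2
  map_act a g h := by
    obtain ⟨s, hs⟩ := Sh.exists_pt (M := ℰ.gammaObj) a
    obtain ⟨x, b⟩ := a
    change x = 𝒢.r g at h
    subst h
    obtain rfl : b = Sh.germ _ _ s := eq_of_heq (Sigma.mk.inj hs).2
    refine (congrArg ℰ.evalFun (Sh.totAct_pt ℰ.gammaObj s (x := 𝒢.r g) rfl
      (Sh.mem_bisectionAt g))).trans ?_
    rw [evalFun_pt]
    refine (congrArg Subtype.val (ℰ.sectionAct_charFun_of_mem s.1 _ ⟨g, rfl⟩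
      (Sh.mem_bisectionAt g))).trans ?_
    change ℰ.act (ℰ.value s (𝒢.r g)).1 g _ = _
    congr 1
    exact (ℰ.evalFun_pt s (𝒢.r g)).symm

theorem evalGSheafHom_fpt (s : ℰ.gammaObj.carrier) (x : X) :
    ℰ.evalGSheafHom.stalkMap x (Sh.fpt ℰ.gammaObj s x) = ℰ.value s x :=
  Subtype.ext (ℰ.evalFun_pt s x)

/-- The counit of the equivalence, `[s]_x ↦ s(x)`. -/
def evalHom : ModuleSheaf.Hom (Sh.shObj ℰ.gammaObj) ℰ where
  toHom := ℰ.evalGSheafHom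
  map_add x a b := by
    obtain ⟨s, rfl⟩ := Sh.exists_fpt _ a
    obtain ⟨t, rfl⟩ := Sh.exists_fpt _ b
    refine (congrArg (ℰ.evalGSheafHom.stalkMap x) (Sh.fpt_add _ s t x)).trans ?_
    change _ = ℰ.evalGSheafHom.stalkMap x _ + ℰ.evalGSheafHom.stalkMap x _
    rw [evalGSheafHom_fpt, evalGSheafHom_fpt, evalGSheafHom_fpt]
    rfl
  map_smul x c a := by
    obtain ⟨s, rfl⟩ := Sh.exists_fpt _ a
    refine (congrArg (ℰ.evalGSheafHom.stalkMap x) (Sh.fpt_smul _ c s x)).trans ?_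
    change _ = c • ℰ.evalGSheafHom.stalkMap x _
    rw [evalGSheafHom_fpt, evalGSheafHom_fpt, value_smul]

theorem evalFun_bijective : Function.Bijective ℰ.evalFun := by
  constructor
  · intro a b h
    have hab : a.1 = b.1 := (ℰ.evalGSheafHom.p_toFun a).symm.trans
      ((congrArg ℰ.p h).trans (ℰ.evalGSheafHom.p_toFun b))
    obtain ⟨s, hs⟩ := Sh.exists_pt a
    obtain ⟨t, ht⟩ := Sh.exists_pt b
    rw [← hab] at ht
    rw [hs, ht, evalFun_pt, evalFun_pt] at h
    rw [hs, ht]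
    exact (Sh.pt_eq_pt _).2 (ℰ.germ_eq_germ_iff.2 (Subtype.ext h))
  · intro a
    obtain ⟨s, hs⟩ := ℰ.exists_value_eq (x := ℰ.p a) ⟨a, rfl⟩
    exact ⟨Sh.pt _ s (ℰ.p a), by rw [evalFun_pt, hs]⟩

end ModuleSheaf

/-! ### The natural isomorphisms -/

/-- The natural isomorphism `1 ≅ Γ_c ∘ Sh`. -/
def unitIso (𝒢 : TopologicalGroupoid X G) [𝒢.IsAmple] (𝕜 : Type w) [CommRing 𝕜] :
    𝟭 (UnitaryRightModule.{max v w, max u t} (GroupoidAlgebra 𝒢 𝕜)) ≅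
      shFunctor.{u, v, w, max u t} 𝒢 𝕜 ⋙ gammaFunctor.{u, v, w, max u t} 𝒢 𝕜 :=
  NatIso.ofComponents
    (fun M => UnitaryRightModule.isoOfBijective (Sh.toSections.{u, v, w, t} M)
      ⟨Sh.toSections_injective.{u, v, w, t} M, Sh.toSections_surjective.{u, v, w, t} M⟩)
    fun f => UnitaryRightModule.Hom.ext (AddMonoidHom.ext fun n =>
      Subtype.ext (funext fun x => (Sh.stalkMap_fpt f n x).symm))

/-- The natural isomorphism `Sh ∘ Γ_c ≅ 1`. -/
def counitIso (𝒢 : TopologicalGroupoid X G) [𝒢.IsAmple] (𝕜 : Type w) [CommRing 𝕜] :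
    gammaFunctor.{u, v, w, max u t} 𝒢 𝕜 ⋙ shFunctor.{u, v, w, max u t} 𝒢 𝕜 ≅
      𝟭 (ModuleSheaf.{u, v, w, max u t} 𝒢 𝕜) :=
  NatIso.ofComponents
    (fun ℰ => ModuleSheaf.isoOfBijective (ModuleSheaf.evalHom.{u, v, w, t} ℰ)
      (ModuleSheaf.evalFun_bijective.{u, v, w, t} ℰ))
    fun {ℰ ℱ} φ => ModuleSheaf.Hom.ext (funext fun a => by
      obtain ⟨s, hs⟩ := Sh.exists_pt (M := ℰ.gammaObj) a
      rw [hs]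
      refine (congrArg (ModuleSheaf.evalFun.{u, v, w, t} ℱ)
        (Sh.totMap_pt (ModuleSheaf.gammaMap φ) s a.1)).trans ?_
      refine (ModuleSheaf.evalFun_pt.{u, v, w, t} ℱ _ a.1).trans ?_
      exact (congrArg φ.toFun (ModuleSheaf.evalFun_pt.{u, v, w, t} ℰ s a.1)).symm)

end

end TopologicalGroupoid

theorem mainTheorem1 {X : Type u} {G : Type v} [TopologicalSpace X] [TopologicalSpace G]
    (𝒢 : TopologicalGroupoid X G) [𝒢.IsAmple] (𝕜 : Type w) [CommRing 𝕜] :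
    Nonempty (TopologicalGroupoid.shFunctor.{u, v, w, max u t} 𝒢 𝕜 ⋙
      TopologicalGroupoid.gammaFunctor.{u, v, w, max u t} 𝒢 𝕜 ≅
        𝟭 (UnitaryRightModule.{max v w, max u t} (TopologicalGroupoid.GroupoidAlgebra 𝒢 𝕜))) ∧
    Nonempty (TopologicalGroupoid.gammaFunctor.{u, v, w, max u t} 𝒢 𝕜 ⋙
      TopologicalGroupoid.shFunctor.{u, v, w, max u t} 𝒢 𝕜 ≅
        𝟭 (TopologicalGroupoid.ModuleSheaf.{u, v, w, max u t} 𝒢 𝕜)) ∧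
    Nonempty (UnitaryRightModule.{max v w, max u t} (TopologicalGroupoid.GroupoidAlgebra 𝒢 𝕜) ≌
      TopologicalGroupoid.ModuleSheaf.{u, v, w, max u t} 𝒢 𝕜) := by
  refine ⟨⟨(TopologicalGroupoid.unitIso.{u, v, w, t} 𝒢 𝕜).symm⟩,
    ⟨TopologicalGroupoid.counitIso.{u, v, w, t} 𝒢 𝕜⟩, ⟨?_⟩⟩
  exact CategoryTheory.Equivalence.mk _ _ (TopologicalGroupoid.unitIso.{u, v, w, t} 𝒢 𝕜)
    (TopologicalGroupoid.counitIso.{u, v, w, t} 𝒢 𝕜)
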